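/- **Notation.** For $N\ge 1$ put $\mathcal D_{U(N)}(\theta_1,\dots,\theta_N)=\prod_{1\le j<k\le N}|e^{i\theta_j}-e^{i\theta_k}|^2$ and let $$\mathcal P_{U(N)}=\frac{1}{N!(2\pi)^N}\mathcal D_{U(N)},\qquad \mathcal P_{SU(N)}=\frac{1}{N!(2\pi)^{N-1}}\mathcal D_{U(N)}\cdot\delta(\theta_1+\dots+\theta_N \bmod 2\pi)$$ be the eigenangle densities on $[-\pi,\pi)^N$ of Haar-distributed $U(N)$ and $SU(N)$ matrices; here $\delta$ is the Dirac delta, i.e. $\mathcal P_{SU(N)}$ is the measure under which $(\theta_1,\dots,\theta_{N-1})$ has density $\frac{1}{N!(2\pi)^{N-1}}\mathcal D_{U(N)}(\theta_1,\dots,\theta_{N-1},-\theta_1-\dots-\theta_{N-1})$ and $\theta_N\in[-\pi,\pi)$ is determined by $\theta_1+\dots+\theta_N\equiv 0 \pmod{2\pi}$. For $G\in\{U,SU\}$, an interval $J\subset[-\pi,\pi)$ and $0\le k\le N$ let $$E_{G(N)}(k,J)=\binom Nk\int_{J^k}\int_{([-\pi,\pi)\smallsetminus J)^{N-k}}\mathcal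 P_{G(N)}\,d\theta_1\cdots d\theta_N,$$ and let $$R^n_{G(N)}(\theta_1,\dots,\theta_n)=\frac{N!}{(N-n)!}\int_{[-\pi,\pi)^{N-n}}\mathcal P_{G(N)}\,d\theta_{n+1}\cdots d\theta_N$$ be the $n$-level densities ($1\le n\le N$ for $U$, $1\le n\le N-1$ for $SU$). Let $X^n=R^n_{SU(N)}-R^n_{U(N)}$ for $1\le n\le N-1$ and $X^N=N!\,\mathcal P_{SU(N)}-R^N_{U(N)}$. Let $\mathcal J=\mathcal J_N=[-\pi,-\pi+\frac{2\pi}{N})$, and let $$\alpha=\frac{4\,[\gamma+\log(2\pi)-\mathrm{Ci}(2\pi)]}{\pi^2},\qquad \mathrm{Ci}(x)=-\int_x^\infty\frac{\cos t}{t}\,dt,$$ with $\gamma$ Euler's constant. **Statement.** 1. For every $N\ge1$, $\int_{\mathcal J}X^1(\theta_1)\,d\theta_1=0$. 2. For every $N\ge 3$, $$\int_{\mathcal J^2}X^2(\theta_1,\theta_2)\,d\theta_1d\theta_2=\frac{4}{\pi^2}\left[\frac{1}{N^2-1}\Big(\sin\frac{\pi}{N}\Big)^2-\sum_{\substack{1\le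 k_1,k_2\le N-1\\ k_1+k_2=N}}\frac{1}{k_1k_2}\sin\Big(\frac{k_1\pi}{N}\Big)\sin\Big(\frac{k_2\pi}{N}\Big)\right].$$ 3. As $N\to\infty$, $\int_{\mathcal J^2}X^2\,d\theta_1d\theta_2=-\frac{\alpha}{N}+O\!\left(\frac1{N^3}\right)$, and $\alpha\approx 0.987944$ (to six decimal places). 4. Write $H_k(N)=\sum_{n=3}^N\frac{(-1)^{n-k}}{k!\,(n-k)!}\int_{\mathcal J^n}X^n\,d\theta_1\cdots d\theta_n$ for the contribution of the terms with $n\ge3$. For every $N\ge3$, $$\begin{aligned}E_{SU(N)}(0,\mathcal J)&=E_{U(N)}(0,\mathcal J)+\tfrac12\int_{\mathcal J^2}X^2+H_0(N),\\ E_{SU(N)}(1,\mathcal J)&=E_{U(N)}(1,\mathcal J)-\int_{\mathcal J^2}X^2+H_1(N),\\ E_{SU(N)}(2,\mathcal J)&=E_{U(N)}(2,\mathcal J)+\tfrac12\int_{\mathcal J^2}X^2+H_2(N),\end{aligned}$$ and consequently, as $N\to\infty$, the first corrections (those coming from the terms $n\le 2$) are $-\frac{\alpha}{2N}$, $+\frac{\alpha}{N}$,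 $-\frac{\alpha}{2N}$: $$\begin{aligned}E_{SU(N)}(0,\mathcal J)&=E_{U(N)}(0,\mathcal J)-\frac{\alpha}{2N}+H_0(N)+O\!\left(\tfrac1{N^3}\right),\\ E_{SU(N)}(1,\mathcal J)&=E_{U(N)}(1,\mathcal J)+\frac{\alpha}{N}+H_1(N)+O\!\left(\tfrac1{N^3}\right),\\ E_{SU(N)}(2,\mathcal J)&=E_{U(N)}(2,\mathcal J)-\frac{\alpha}{2N}+H_2(N)+O\!\left(\tfrac1{N^3}\right).\end{aligned}$$ -/

import Mathlib

open MeasureTheory Filter Asymptotics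

noncomputable section

namespace GramLaw

/-- The box `[-π, π)^m`. -/
def box (m : ℕ) : Set (Fin m → ℝ) := Set.univ.pi fun _ => Set.Ico (-Real.pi) Real.pi

/-- The cube `J^m`. -/
def cube (m : ℕ) (J : Set ℝ) : Set (Fin m → ℝ) := Set.univ.pi fun _ => J

/-- For `n ≤ N`, the tuple `(θ₁, …, θₙ, φ₁, …, φ_{N-n})`. -/
def glue {n N : ℕ} (θ : Fin n → ℝ) (φ : Fin (N - n) → ℝ) : Fin N → ℝ := fun i =>
  if h : (i : ℕ) < n then θ ⟨i, h⟩ else φ ⟨i - n, by omega⟩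

/-- The `U(N)` Dyson product `∏_{j<k} |e^{iθ_j} - e^{iθ_k}|²`. -/
def dysonU (N : ℕ) (θ : Fin N → ℝ) : ℝ :=
  ∏ j : Fin N, ∏ k ∈ Finset.Ioi j,
    ‖Complex.exp (Complex.I * (θ j : ℂ)) - Complex.exp (Complex.I * (θ k : ℂ))‖ ^ 2

/-- The `U(N)` eigenangle density. -/
def densityU (N : ℕ) (θ : Fin N → ℝ) : ℝ :=
  1 / ((N.factorial : ℝ) * (2 * Real.pi) ^ N) * dysonU N θ

/-- The `SU(N)` Dyson product
`D_U(θ₁, …, θ_{N-1}, -θ₁ - … - θ_{N-1})` (for `1 ≤ N`). -/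
def dysonSU (N : ℕ) (θ : Fin (N - 1) → ℝ) : ℝ :=
  dysonU N (glue θ fun _ => -∑ i, θ i)

/-- The representative in `[-π, π)` of `x` modulo `2π`. -/
def wrap (x : ℝ) : ℝ := toIcoMod Real.two_pi_pos (-Real.pi) x

/-- The law of the `N` eigenangles in `[-π, π)^N` of a random `SU(N)` matrix (for `1 ≤ N`), that is
`(1 / (N! (2π)^{N-1})) D_U(θ₁, …, θ_N) δ(θ₁ + … + θ_N mod 2π) dθ₁ … dθ_N`.
Integrating out the delta function in the last variable, this is the image of the measure
`(1 / (N! (2π)^{N-1})) D_SU(θ₁, …, θ_{N-1}) dθ₁ … dθ_{N-1}` on `[-π, π)^{N-1}` under the map that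
appends the angle `θ_N ∈ [-π, π)` with `θ₁ + … + θ_N ≡ 0 mod 2π`. -/
def lawSU (N : ℕ) : Measure (Fin N → ℝ) :=
  ((volume.restrict (box (N - 1))).withDensity fun θ =>
      ENNReal.ofReal (1 / ((N.factorial : ℝ) * (2 * Real.pi) ^ (N - 1)) * dysonSU N θ)).map
    fun θ => glue θ fun _ => wrap (-∑ i, θ i)

/-- The region `J^k × ([-π, π) \ J)^{N-k}`. -/
def region (N k : ℕ) (J : Set ℝ) : Set (Fin N → ℝ) :=
  Set.univ.pi fun i => if (i : ℕ) < k then J else Set.Ico (-Real.pi) Real.pi \ J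

/-- The probability that `J` contains exactly `k` eigenangles of a random `U(N)` matrix. -/
def probU (N k : ℕ) (J : Set ℝ) : ℝ :=
  (N.choose k : ℝ) * ∫ θ in region N k J, densityU N θ

/-- The probability that `J` contains exactly `k` eigenangles of a random `SU(N)` matrix. -/
def probSU (N k : ℕ) (J : Set ℝ) : ℝ :=
  (N.choose k : ℝ) * (lawSU N).real (region N k J)

/-- The `U(N)` `n`-level density, for `n ≤ N`. -/
def levelU (N n : ℕ) (θ : Fin n → ℝ) : ℝ :=
  (N.factorial : ℝ) / ((N - n).factorial : ℝ) *
    ∫ φ in box (N - n), densityU N (glue θ φ)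

/-- The `SU(N)` `n`-level density, for `n ≤ N - 1`. -/
def levelSU (N n : ℕ) (θ : Fin n → ℝ) : ℝ :=
  1 / (((N - n).factorial : ℝ) * (2 * Real.pi) ^ (N - 1)) *
    ∫ φ in box (N - 1 - n), dysonSU N (glue θ φ)

/-- The integral over `J^n` of `Xⁿ`, where `X⁰ = 0`, `Xⁿ = Rⁿ_SU - Rⁿ_U` for `1 ≤ n ≤ N - 1`, and
`X^N = N! P_SU - R^N_U`, the density `P_SU` being the measure `lawSU N`. -/
def integralX (N n : ℕ) (J : Set ℝ) : ℝ :=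
  if n = 0 then 0
  else if n < N then ∫ θ in cube n J, (levelSU N n θ - levelU N n θ)
  else (N.factorial : ℝ) * (lawSU N).real (cube N J) - ∫ θ in cube N J, levelU N N θ

/-- The `SU(N)` Gram interval `[-π, -π + 2π/N)`. -/
def gramInterval (N : ℕ) : Set ℝ := Set.Ico (-Real.pi) (-Real.pi + 2 * Real.pi / N)

/-- The cosine integral `Ci(x) = -∫_x^∞ cos t / t dt` (an improper integral), for `x > 0`. -/
def cosIntegral (x : ℝ) : ℝ :=
  -limUnder atTop fun T : ℝ => ∫ t in x..T, Real.cos t / t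

/-- The constant `α = 4 (γ + log 2π - Ci(2π)) / π²`. -/
def alpha : ℝ :=
  4 * (Real.eulerMascheroniConstant + Real.log (2 * Real.pi) - cosIntegral (2 * Real.pi)) /
    Real.pi ^ 2

/-- The sum of the terms `3 ≤ n ≤ N` of the expansion
`E_SU(k, J) = E_U(k, J) + ∑_{n=k}^N ((-1)^{n-k} / (k! (n-k)!)) ∫_{J^n} Xⁿ` for `k ≤ 3`. -/
def higherTerms (N k : ℕ) (J : Set ℝ) : ℝ :=
  ∑ n ∈ Finset.Icc 3 N,
    (-1 : ℝ) ^ (n - k) / ((k.factorial : ℝ) * ((n - k).factorial : ℝ)) * integralX N n J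

end GramLaw

end

/-! Everything rests on a Fourier expansion. The Dyson product is the squared modulus of a
Vandermonde determinant, hence a signed sum over pairs (σ, τ) of permutations of characters with
frequency σ_j − τ_j in θ_j. On a cell J^n × [-π, π)^{N-n} with n < N, integration for U(N) kills
every pair with a nonzero frequency in a full-range angle. For SU(N), substituting θ_N = −∑ θ_i
subtracts the frequency of θ_N from all the others, so a pair survives as soon as all full-range
angles share one frequency. Common frequency 0 reproduces the U(N) terms, so the difference of the
two laws is carried by the nonzero common frequencies (`law_difference`), and exchanging σ and τ
reduces these to −m with m > 0.

Then τ is σ followed by the cyclic shift by m, up to a permutation κ of the first n indices. If κ =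
1, the index with σ_j = N − 1 gets relative frequency exactly N, where the Fourier integral over an
interval of length 2π/N vanishes (`pairTerm_shifted`). So nothing survives for n ≤ 1, and for n = 2
only the transposition κ does. An index pushed past N − 1 by the shift cannot be a full-range one,
so m ≤ 2: m = 1 gives the sine sum and m = 2 gives the term sin²(π/N)/(N² − 1).

By partial fractions, N times the sine sum is a trapezoidal sum of a C² function whose integral is
`cin (2 * Real.pi)` (`sineSum_eq`), and the trapezoidal error O(N⁻²) gives the asymptotics. The
identity cin x = γ + log x − Ci x (`cosIntegral_eq`) comes from a quarter-circle contour and Γ'(1) =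
−γ; the decimals of α come from a Taylor polynomial.

The probabilities follow by inclusion–exclusion (`choose_mul_measureReal_region`), which needs both
laws to be invariant under permutations of the angles. For SU(N) this is hidden by the special role
of the last angle, and is recovered by exchanging it with the others (`measurePreserving_lawSU`). -/

namespace GramLaw

/-! ### The Dyson product as a sum of characters. -/

/-- The unimodular numbers `e^{iθ_j}`. -/
noncomputable def eigenvalues {N : ℕ} (θ : Fin N → ℝ) : Fin N → ℂ :=
  fun j => Complex.exp (Complex.I * (θ j : ℂ))

theorem dysonU_eq_norm_det {N : ℕ} (θ : Fin N → ℝ) :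
    dysonU N θ = ‖(Matrix.vandermonde (eigenvalues θ)).det‖ ^ 2 := by
  rw [Matrix.det_vandermonde, norm_prod, ← Finset.prod_pow]
  refine Finset.prod_congr rfl fun j _ => ?_
  rw [norm_prod, ← Finset.prod_pow]
  exact Finset.prod_congr rfl fun k _ => by rw [norm_sub_rev]; rfl

theorem dysonU_nonneg {N : ℕ} (θ : Fin N → ℝ) : 0 ≤ dysonU N θ := by
  rw [dysonU_eq_norm_det]; positivity

theorem continuous_dysonU (N : ℕ) : Continuous (dysonU N) := by
  unfold dysonU; fun_prop

theorem dysonU_comp_perm {N : ℕ} (θ : Fin N → ℝ) (e : Equiv.Perm (Fin N)) :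
    dysonU N (θ ∘ e) = dysonU N θ := by
  rw [dysonU_eq_norm_det, dysonU_eq_norm_det]
  have h : Matrix.vandermonde (eigenvalues (θ ∘ e))
      = (Matrix.vandermonde (eigenvalues θ)).submatrix e id := by
    ext i j; simp [Matrix.vandermonde, eigenvalues]
  rw [h, Matrix.det_permute, norm_mul]
  rcases Int.units_eq_one_or (Equiv.Perm.sign e) with h | h <;> simp [h]

theorem dysonU_congr {N : ℕ} {θ θ' : Fin N → ℝ}
    (h : ∀ j, Complex.exp (Complex.I * (θ j : ℂ)) = Complex.exp (Complex.I * (θ' j : ℂ))) :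
    dysonU N θ = dysonU N θ' := by
  simp only [dysonU, h]

theorem exp_wrap (x : ℝ) :
    Complex.exp (Complex.I * (wrap x : ℂ)) = Complex.exp (Complex.I * (x : ℂ)) := by
  obtain ⟨z, hz⟩ : ∃ z : ℤ, wrap x = x - z * (2 * Real.pi) :=
    ⟨toIcoDiv Real.two_pi_pos (-Real.pi) x, by rw [wrap, toIcoMod, zsmul_eq_mul]⟩
  rw [hz]
  refine Complex.exp_eq_exp_iff_exists_int.2 ⟨-z, ?_⟩
  push_cast; ring

/-- The exponent `σ_j - τ_j` of `e^{iθ_j}` in the expansion of the Dyson product. -/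
def freq {N : ℕ} (σ τ : Equiv.Perm (Fin N)) (j : Fin N) : ℤ := (σ j : ℤ) - (τ j : ℤ)

/-- The character `θ ↦ e^{idθ}`. -/
noncomputable def angleChar (d : ℤ) (x : ℝ) : ℂ := Complex.exp (Complex.I * (d * x))

/-- Leibniz expansion of the Vandermonde determinant times its conjugate; on the unit circle
conjugation inverts, so the exponents subtract. -/
theorem dysonU_expansion {N : ℕ} (θ : Fin N → ℝ) :
    (dysonU N θ : ℂ) = ∑ σ : Equiv.Perm (Fin N), ∑ τ : Equiv.Perm (Fin N),
      ((Equiv.Perm.sign σ : ℤ) * (Equiv.Perm.sign τ : ℤ) : ℂ) *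
        ∏ j, angleChar (freq σ τ j) (θ j) := by
  rw [dysonU_eq_norm_det, Complex.ofReal_pow, ← Complex.mul_conj', ← Matrix.det_transpose,
    Matrix.det_apply, map_sum, Finset.sum_mul_sum]
  refine Finset.sum_congr rfl fun σ _ => Finset.sum_congr rfl fun τ _ => ?_
  simp only [Units.smul_def, zsmul_eq_mul, map_mul, map_prod, Matrix.transpose_apply,
    Matrix.vandermonde_apply]
  have : ∀ j, angleChar (freq σ τ j) (θ j) =
      eigenvalues θ j ^ (σ j : ℕ) * (starRingEnd ℂ) (eigenvalues θ j ^ (τ j : ℕ)) := by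
    intro j
    rw [angleChar, freq, eigenvalues, map_pow, ← Complex.exp_conj, ← Complex.exp_nat_mul,
      ← Complex.exp_nat_mul, ← Complex.exp_add]
    congr 1
    simp only [map_mul, Complex.conj_I, Complex.conj_ofReal]
    push_cast; ring
  simp only [this, Finset.prod_mul_distrib, map_intCast]
  ring

/-! ### Splitting tuples of angles, and product measures. -/

theorem glue_of_lt {n N : ℕ} (θ : Fin n → ℝ) (φ : Fin (N - n) → ℝ) (i : Fin N) (h : (i : ℕ) < n) :
    glue θ φ i = θ ⟨i, h⟩ := dif_pos h

theorem glue_of_not_lt {n N : ℕ} (θ : Fin n → ℝ) (φ : Fin (N - n) → ℝ) (i : Fin N)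
    (h : ¬ (i : ℕ) < n) : glue θ φ i = φ ⟨i - n, by omega⟩ := dif_neg h

theorem prod_fin_split {M : Type*} [CommMonoid M] {n N : ℕ} (h : n ≤ N) (a : Fin N → M) :
    ∏ i, a i = (∏ i : Fin n, a (i.castLE h)) * ∏ j : Fin (N - n), a ⟨n + j, by omega⟩ := by
  obtain ⟨k, rfl⟩ := Nat.exists_eq_add_of_le h
  rw [Fin.prod_univ_add]
  congr 1
  refine Fintype.prod_equiv (finCongr (by omega)) _ _ fun j => ?_
  congr 1

theorem prod_fin_split_last {M : Type*} [CommMonoid M] {N : ℕ} (h : 1 ≤ N) (a : Fin N → M) :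
    ∏ i, a i = (∏ i : Fin (N - 1), a (i.castLE (Nat.sub_le N 1))) * a ⟨N - 1, by omega⟩ := by
  rw [prod_fin_split (Nat.sub_le N 1)]
  congr 1
  have : Unique (Fin (N - (N - 1))) := by
    rw [show N - (N - 1) = 1 by omega]; infer_instance
  rw [Fintype.prod_unique]
  congr 1
  ext
  simp only
  have := (default : Fin (N - (N - 1))).2
  omega

theorem sum_fin_split_last {M : Type*} [AddCommMonoid M] {N : ℕ} (h : 1 ≤ N) (a : Fin N → M) :
    ∑ i, a i = (∑ i : Fin (N - 1), a (i.castLE (Nat.sub_le N 1))) + a ⟨N - 1, by omega⟩ :=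
  prod_fin_split_last (M := Multiplicative M) h a

theorem measurable_glue {n N : ℕ} :
    Measurable fun p : (Fin n → ℝ) × (Fin (N - n) → ℝ) => (glue p.1 p.2 : Fin N → ℝ) := by
  refine measurable_pi_lambda _ fun i => ?_
  by_cases h : (i : ℕ) < n
  · simp only [glue_of_lt _ _ i h]; fun_prop
  · simp only [glue_of_not_lt _ _ i h]; fun_prop

theorem measurePreserving_glue {n N : ℕ} (h : n ≤ N) (μ : Fin N → Measure ℝ)
    [∀ i, SigmaFinite (μ i)] :
    MeasurePreserving
      (fun p : (Fin n → ℝ) × (Fin (N - n) → ℝ) => (glue p.1 p.2 : Fin N → ℝ))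
      ((Measure.pi fun i : Fin n => μ (i.castLE h)).prod
        (Measure.pi fun j : Fin (N - n) => μ ⟨n + j, by omega⟩)) (Measure.pi μ) := by
  refine ⟨measurable_glue, (Measure.pi_eq fun s hs => ?_).symm⟩
  rw [Measure.map_apply measurable_glue (MeasurableSet.univ_pi hs)]
  have : (fun p : (Fin n → ℝ) × (Fin (N - n) → ℝ) => (glue p.1 p.2 : Fin N → ℝ)) ⁻¹'
      Set.univ.pi s = (Set.univ.pi fun i : Fin n => s (i.castLE h)) ×ˢ
        (Set.univ.pi fun j : Fin (N - n) => s ⟨n + j, by omega⟩) := by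
    ext ⟨θ, φ⟩
    simp only [Set.mem_preimage, Set.mem_univ_pi, Set.mem_prod]
    constructor
    · refine fun H => ⟨fun i => ?_, fun j => ?_⟩
      · simpa [glue] using H (i.castLE h)
      · simpa [glue] using H ⟨n + j, by omega⟩
    · rintro ⟨H1, H2⟩ i
      by_cases hi : (i : ℕ) < n
      · rw [glue_of_lt _ _ i hi]; exact H1 ⟨i, hi⟩
      · rw [glue_of_not_lt _ _ i hi]
        have := H2 ⟨i - n, by omega⟩
        have e : (⟨n + (i - n), by omega⟩ : Fin N) = i := by ext; simp only; omega
        simpa only [e] using this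
  rw [this, Measure.prod_prod, Measure.pi_pi, Measure.pi_pi, prod_fin_split h fun i => μ i (s i)]

/-! ### Level densities as masses of cells. -/

/-- The cell `J^n × [-π, π)^{N-n}`. -/
def cell (N n : ℕ) (J : Set ℝ) : Set (Fin N → ℝ) :=
  Set.univ.pi fun i => if (i : ℕ) < n then J else Set.Ico (-Real.pi) Real.pi

theorem measurableSet_box (m : ℕ) : MeasurableSet (box m) :=
  MeasurableSet.univ_pi fun _ => measurableSet_Ico

theorem measurableSet_cell (N n : ℕ) {J : Set ℝ} (hJ : MeasurableSet J) :
    MeasurableSet (cell N n J) :=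
  MeasurableSet.univ_pi fun i => by split_ifs; exacts [hJ, measurableSet_Ico]

theorem cell_subset_box (N n : ℕ) {J : Set ℝ} (hJ : J ⊆ Set.Ico (-Real.pi) Real.pi) :
    cell N n J ⊆ box N :=
  Set.pi_mono fun i _ => by split_ifs; exacts [hJ, subset_rfl]

theorem cell_self (N : ℕ) (J : Set ℝ) : cell N N J = cube N J := by
  simp [cell, cube]

theorem cell_zero (N : ℕ) (J : Set ℝ) : cell N 0 J = box N := by
  simp [cell, box]

theorem box_subset_Icc (m : ℕ) : box m ⊆ Set.Icc (fun _ => -Real.pi) (fun _ => Real.pi) :=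
  fun _ hθ => ⟨fun i => (hθ i trivial).1, fun i => (hθ i trivial).2.le⟩

theorem integrableOn_of_subset_box {m : ℕ} {E : Type*} [NormedAddCommGroup E]
    {F : (Fin m → ℝ) → E} (hF : Continuous F) {S : Set (Fin m → ℝ)} (hS : S ⊆ box m) :
    IntegrableOn F S :=
  (hF.continuousOn.integrableOn_compact isCompact_Icc).mono_set (hS.trans (box_subset_Icc m))

theorem measurePreserving_glue_cell {n N : ℕ} (h : n ≤ N) (J : Set ℝ) :
    MeasurePreserving
      (fun p : (Fin n → ℝ) × (Fin (N - n) → ℝ) => (glue p.1 p.2 : Fin N → ℝ))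
      ((volume.restrict (cube n J)).prod (volume.restrict (box (N - n))))
      (volume.restrict (cell N n J)) := by
  have := measurePreserving_glue h fun i : Fin N =>
    (volume : Measure ℝ).restrict (if (i : ℕ) < n then J else Set.Ico (-Real.pi) Real.pi)
  simpa only [← Measure.restrict_pi_pi, cell, cube, box, Fin.val_castLE, Fin.is_lt, if_true,
    Nat.not_lt.2 (Nat.le_add_right _ _), if_false, volume_pi] using this

theorem integrable_glue_cell {n N : ℕ} (h : n ≤ N) {J : Set ℝ}
    (hJ : J ⊆ Set.Ico (-Real.pi) Real.pi) {F : (Fin N → ℝ) → ℝ} (hF : Continuous F) :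
    Integrable (fun p : (Fin n → ℝ) × (Fin (N - n) → ℝ) => F (glue p.1 p.2))
      ((volume.restrict (cube n J)).prod (volume.restrict (box (N - n)))) :=
  (measurePreserving_glue_cell h J).integrable_comp_of_integrable
    (integrableOn_of_subset_box hF (cell_subset_box N n hJ))

theorem integrable_integral_glue {n N : ℕ} (h : n ≤ N) {J : Set ℝ}
    (hJ : J ⊆ Set.Ico (-Real.pi) Real.pi) {F : (Fin N → ℝ) → ℝ} (hF : Continuous F) :
    IntegrableOn (fun θ : Fin n → ℝ => ∫ φ in box (N - n), F (glue θ φ)) (cube n J) :=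
  (integrable_glue_cell h hJ hF).integral_prod_left

theorem integral_integral_glue {n N : ℕ} (h : n ≤ N) {J : Set ℝ}
    (hJ : J ⊆ Set.Ico (-Real.pi) Real.pi) {F : (Fin N → ℝ) → ℝ} (hF : Continuous F) :
    ∫ θ in cube n J, ∫ φ in box (N - n), F (glue θ φ) = ∫ θ in cell N n J, F θ := by
  have mp := measurePreserving_glue_cell h J
  rw [← integral_prod _ (integrable_glue_cell h hJ hF), ← mp.map_eq,
    integral_map mp.measurable.aemeasurable hF.aestronglyMeasurable]

theorem withDensity_real_apply {m : ℕ} {f : (Fin m → ℝ) → ℝ} (hf : Continuous f)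
    (h0 : ∀ θ, 0 ≤ f θ) {S : Set (Fin m → ℝ)} (hS : MeasurableSet S) (hSb : S ⊆ box m) :
    ((volume.restrict (box m)).withDensity fun θ => ENNReal.ofReal (f θ)).real S =
      ∫ θ in S, f θ := by
  rw [measureReal_def, withDensity_apply _ hS, Measure.restrict_restrict hS,
    Set.inter_eq_left.2 hSb,
    ← ofReal_integral_eq_lintegral_ofReal (integrableOn_of_subset_box hf hSb) (.of_forall h0),
    ENNReal.toReal_ofReal (integral_nonneg h0)]

/-- The law of the `N` eigenangles in `[-π, π)^N` of a random `U(N)` matrix. -/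
noncomputable def lawU (N : ℕ) : Measure (Fin N → ℝ) :=
  (volume.restrict (box N)).withDensity fun θ => ENNReal.ofReal (densityU N θ)

theorem continuous_densityU (N : ℕ) : Continuous (densityU N) :=
  continuous_const.mul (continuous_dysonU N)

theorem densityU_nonneg {N : ℕ} (θ : Fin N → ℝ) : 0 ≤ densityU N θ :=
  mul_nonneg (by positivity) (dysonU_nonneg θ)

theorem lawU_real {N : ℕ} {S : Set (Fin N → ℝ)} (hS : MeasurableSet S) (hSb : S ⊆ box N) :
    (lawU N).real S = ∫ θ in S, densityU N θ :=
  withDensity_real_apply (continuous_densityU N) densityU_nonneg hS hSb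

theorem continuous_dysonSU (N : ℕ) : Continuous (dysonSU N) := by
  refine (continuous_dysonU N).comp (continuous_pi fun i => ?_)
  by_cases h : (i : ℕ) < N - 1
  · simp only [glue_of_lt _ _ i h]; fun_prop
  · simp only [glue_of_not_lt _ _ i h]; fun_prop

theorem dysonSU_nonneg {N : ℕ} (θ : Fin (N - 1) → ℝ) : 0 ≤ dysonSU N θ := dysonU_nonneg _

/-- The tuple in `[-π, π)^N` with sum `≡ 0 mod 2π` determined by its first `N - 1` entries. -/
noncomputable def complete {N : ℕ} (θ : Fin (N - 1) → ℝ) : Fin N → ℝ :=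
  glue θ fun _ => wrap (-∑ i, θ i)

theorem wrap_mem (x : ℝ) : wrap x ∈ Set.Ico (-Real.pi) Real.pi := by
  have := toIcoMod_mem_Ico Real.two_pi_pos (-Real.pi) x
  rwa [show -Real.pi + 2 * Real.pi = Real.pi by ring] at this

theorem measurable_wrap : Measurable wrap := by
  have : wrap = fun x => -Real.pi + Int.fract ((x - -Real.pi) / (2 * Real.pi)) * (2 * Real.pi) := by
    funext x
    rw [wrap, toIcoMod_eq_add_fract_mul]
  rw [this]
  fun_prop

theorem measurable_complete {N : ℕ} : Measurable (complete : (Fin (N - 1) → ℝ) → Fin N → ℝ) := by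
  have : Measurable fun θ : Fin (N - 1) → ℝ => wrap (-∑ i, θ i) := measurable_wrap.comp (by fun_prop)
  exact measurable_glue.comp (measurable_id.prodMk (measurable_pi_lambda _ fun _ => this))

/-- The density of the first `N - 1` eigenangles under `lawSU`. -/
noncomputable def densitySU (N : ℕ) (θ : Fin (N - 1) → ℝ) : ℝ :=
  1 / ((N.factorial : ℝ) * (2 * Real.pi) ^ (N - 1)) * dysonSU N θ

theorem continuous_densitySU (N : ℕ) : Continuous (densitySU N) :=
  continuous_const.mul (continuous_dysonSU N)

theorem densitySU_nonneg {N : ℕ} (θ : Fin (N - 1) → ℝ) : 0 ≤ densitySU N θ :=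
  mul_nonneg (by positivity) (dysonSU_nonneg θ)

theorem lawSU_eq (N : ℕ) : lawSU N = ((volume.restrict (box (N - 1))).withDensity fun θ =>
    ENNReal.ofReal (densitySU N θ)).map complete := rfl

/-- Since n < N, the cell only asks the dependent angle to lie in [-π, π), which `wrap` guarantees;
the condition bears on the first N − 1 angles alone. -/
theorem lawSU_real_cell {N n : ℕ} (hn : n < N) {J : Set ℝ} (hJm : MeasurableSet J)
    (hJ : J ⊆ Set.Ico (-Real.pi) Real.pi) :
    (lawSU N).real (cell N n J) = ∫ θ in cell (N - 1) n J, densitySU N θ := by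
  rw [← withDensity_real_apply (continuous_densitySU N) densitySU_nonneg
    (measurableSet_cell (N - 1) n hJm) (cell_subset_box (N - 1) n hJ), lawSU_eq,
    map_measureReal_apply measurable_complete (measurableSet_cell N n hJm), measureReal_def,
    measureReal_def]
  congr 2
  ext θ
  simp only [Set.mem_preimage, cell, Set.mem_univ_pi]
  constructor
  · intro H i
    have := H (i.castLE (Nat.sub_le N 1))
    rwa [complete, glue_of_lt _ _ _ (by simp)] at this
  · intro H i
    by_cases hi : (i : ℕ) < N - 1
    · have := H ⟨i, hi⟩
      rwa [complete, glue_of_lt _ _ _ hi]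
    · rw [complete, glue_of_not_lt _ _ _ hi, if_neg (by omega)]
      exact wrap_mem _

theorem levelU_integral {N n : ℕ} (hn : n ≤ N) {J : Set ℝ} (hJm : MeasurableSet J)
    (hJ : J ⊆ Set.Ico (-Real.pi) Real.pi) :
    ∫ θ in cube n J, levelU N n θ =
      (N.factorial : ℝ) / ((N - n).factorial : ℝ) * (lawU N).real (cell N n J) := by
  simp only [levelU]
  rw [integral_const_mul, integral_integral_glue hn hJ (continuous_densityU N),
    lawU_real (measurableSet_cell N n hJm) (cell_subset_box N n hJ)]

theorem levelSU_eq (N n : ℕ) (θ : Fin n → ℝ) : levelSU N n θ =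
    (N.factorial : ℝ) / ((N - n).factorial : ℝ) *
      ∫ φ in box (N - 1 - n), densitySU N (glue θ φ) := by
  simp only [levelSU, densitySU]
  rw [integral_const_mul, ← mul_assoc]
  congr 1
  have : (N.factorial : ℝ) ≠ 0 := by positivity
  field_simp

theorem levelSU_integral {N n : ℕ} (hn : n < N) {J : Set ℝ} (hJm : MeasurableSet J)
    (hJ : J ⊆ Set.Ico (-Real.pi) Real.pi) :
    ∫ θ in cube n J, levelSU N n θ =
      (N.factorial : ℝ) / ((N - n).factorial : ℝ) * (lawSU N).real (cell N n J) := by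
  simp only [levelSU_eq]
  rw [integral_const_mul, integral_integral_glue (by omega) hJ (continuous_densitySU N),
    lawSU_real_cell hn hJm hJ]

/-- Fubini for n < N; for n = N the factor (N − n)! is 1 and the cell is the cube. This puts both
branches of `integralX` in one form. -/
theorem integralX_eq {N n : ℕ} (h0 : n ≠ 0) (hn : n ≤ N) {J : Set ℝ} (hJm : MeasurableSet J)
    (hJ : J ⊆ Set.Ico (-Real.pi) Real.pi) :
    integralX N n J = (N.factorial : ℝ) / ((N - n).factorial : ℝ) *
      ((lawSU N).real (cell N n J) - (lawU N).real (cell N n J)) := by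
  rw [integralX, if_neg h0]
  split_ifs with hlt
  · rw [integral_sub, levelSU_integral hlt hJm hJ, levelU_integral hn hJm hJ, mul_sub]
    · exact ((integrable_integral_glue (by omega) hJ (continuous_densitySU N)).const_mul _).congr
        (.of_forall fun θ => (levelSU_eq N n θ).symm)
    · exact (integrable_integral_glue hn hJ (continuous_densityU N)).const_mul _
  · obtain rfl : n = N := by omega
    rw [levelU_integral le_rfl hJm hJ, cell_self]
    simp [mul_sub]

/-! ### Invariance of both laws under permutations of the angles. -/

theorem wrap_eq_self {x : ℝ} (h : x ∈ Set.Ico (-Real.pi) Real.pi) : wrap x = x := by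
  rw [wrap, toIcoMod_eq_self]
  rwa [show -Real.pi + 2 * Real.pi = Real.pi by ring]

theorem wrap_sub_wrap_sub (x y : ℝ) (h : x ∈ Set.Ico (-Real.pi) Real.pi) :
    wrap (-(wrap (-(x + y)) + y)) = x := by
  have : -(wrap (-(x + y)) + y) =
      x + toIcoDiv Real.two_pi_pos (-Real.pi) (-(x + y)) • (2 * Real.pi) := by
    rw [wrap, toIcoMod]; ring
  rw [this, wrap, toIcoMod_add_zsmul]
  exact wrap_eq_self h

/-- On the circle ℝ/2πℤ the substitution is a translation followed by a reflection, and both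
preserve Haar measure. -/
theorem lintegral_wrap_reflect (c : ℝ) (g : ℝ → ENNReal) :
    ∫⁻ t in Set.Ico (-Real.pi) Real.pi, g (wrap (-(t + c))) =
      ∫⁻ t in Set.Ico (-Real.pi) Real.pi, g t := by
  have : Fact (0 < 2 * Real.pi) := ⟨Real.two_pi_pos⟩
  set F : AddCircle (2 * Real.pi) → ENNReal :=
    fun b => g (AddCircle.equivIco (2 * Real.pi) (-Real.pi) b)
  have hF : ∀ t : ℝ, F t = g (wrap t) := fun t => rfl
  have key : ∀ G : AddCircle (2 * Real.pi) → ENNReal,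
      ∫⁻ t in Set.Ico (-Real.pi) Real.pi, G t = ∫⁻ b, G b := fun G => by
    rw [← AddCircle.lintegral_preimage _ (-Real.pi), ← restrict_Ico_eq_restrict_Ioc,
      show -Real.pi + 2 * Real.pi = Real.pi by ring]
  calc ∫⁻ t in Set.Ico (-Real.pi) Real.pi, g (wrap (-(t + c)))
      = ∫⁻ t in Set.Ico (-Real.pi) Real.pi, (fun b : AddCircle (2 * Real.pi) => F (-(b + (c : AddCircle (2 * Real.pi)))))
          (t : AddCircle (2 * Real.pi)) := by
        simp only [← hF]; rfl
    _ = ∫⁻ b, F b := by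
        rw [key fun b => F (-(b + (c : AddCircle (2 * Real.pi)))),
          lintegral_add_right_eq_self (fun b => F (-b)), lintegral_neg_eq_self]
    _ = ∫⁻ t in Set.Ico (-Real.pi) Real.pi, g t := by
        rw [← key]
        exact setLIntegral_congr_fun measurableSet_Ico fun t ht => by rw [hF, wrap_eq_self ht]

/-- The entry `θ_i` is exchanged with the dependent entry of `complete θ`. -/
noncomputable def exchange {m : ℕ} (i : Fin m) (θ : Fin m → ℝ) : Fin m → ℝ :=
  Function.update θ i (wrap (-∑ j, θ j))

theorem measurable_exchange {m : ℕ} (i : Fin m) : Measurable (exchange i) := by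
  have : Measurable fun θ : Fin m → ℝ => wrap (-∑ i, θ i) := measurable_wrap.comp (by fun_prop)
  refine measurable_pi_lambda _ fun j => ?_
  by_cases h : j = i
  · subst h; simpa [exchange] using this
  · simpa [exchange, h] using measurable_pi_apply j

theorem restrict_box (m : ℕ) : (volume : Measure (Fin m → ℝ)).restrict (box m) =
    Measure.pi fun _ => volume.restrict (Set.Ico (-Real.pi) Real.pi) := by
  rw [box, volume_pi, Measure.restrict_pi_pi]

/-- With the other coordinates fixed, `exchange i` acts on θ_i as a reflection of the circle, so the
marginal integrals in that coordinate agree. -/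
theorem measurePreserving_exchange {m : ℕ} (i : Fin m) :
    MeasurePreserving (exchange i) (volume.restrict (box m)) (volume.restrict (box m)) := by
  refine ⟨measurable_exchange i, Measure.ext_of_lintegral _ fun f hf => ?_⟩
  rw [lintegral_map hf (measurable_exchange i), restrict_box]
  refine lintegral_eq_of_lmarginal_eq {i} (hf.comp (measurable_exchange i)) hf ?_
  funext θ
  rw [lmarginal_singleton, lmarginal_singleton]
  convert lintegral_wrap_reflect (∑ j ∈ Finset.univ \ {i}, θ j)
    (fun t => f (Function.update θ i t)) using 4 with t
  simp [exchange, Finset.sum_update_of_mem]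

theorem measurePreserving_withDensity {α : Type*} [MeasurableSpace α] {μ : Measure α} {T : α → α}
    (hT : MeasurePreserving T μ μ) {f : α → ENNReal} (hf : Measurable f)
    (h : ∀ᵐ x ∂μ, f (T x) = f x) :
    MeasurePreserving T (μ.withDensity f) (μ.withDensity f) := by
  refine ⟨hT.measurable, Measure.ext fun S hS => ?_⟩
  rw [Measure.map_apply hT.measurable hS, withDensity_apply _ hS,
    withDensity_apply _ (hT.measurable hS), ← hT.setLIntegral_comp_preimage hS hf]
  exact lintegral_congr_ae (ae_restrict_of_ae (h.mono fun _ hx => hx.symm))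

theorem measurePreserving_comp_perm {N : ℕ} (μ : Measure ℝ) [SigmaFinite μ]
    (e : Equiv.Perm (Fin N)) :
    MeasurePreserving (fun θ : Fin N → ℝ => θ ∘ e) (Measure.pi fun _ => μ)
      (Measure.pi fun _ => μ) := by
  have hm : Measurable fun θ : Fin N → ℝ => θ ∘ e := by
    refine measurable_pi_lambda _ fun i => ?_
    exact measurable_pi_apply (e i)
  refine ⟨hm, (Measure.pi_eq fun s hs => ?_).symm⟩
  rw [Measure.map_apply hm (MeasurableSet.univ_pi hs)]
  have : (fun θ : Fin N → ℝ => θ ∘ e) ⁻¹' Set.univ.pi s = Set.univ.pi fun i => s (e.symm i) := by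
    ext θ
    simp only [Set.mem_preimage, Set.mem_univ_pi, Function.comp]
    exact ⟨fun H i => by simpa using H (e.symm i), fun H i => by simpa using H (e i)⟩
  rw [this, Measure.pi_pi]
  exact Equiv.prod_comp e.symm fun i => μ (s i)

theorem measurePreserving_lawU {N : ℕ} (e : Equiv.Perm (Fin N)) :
    MeasurePreserving (fun θ : Fin N → ℝ => θ ∘ e) (lawU N) (lawU N) := by
  refine measurePreserving_withDensity (by rw [restrict_box]; exact measurePreserving_comp_perm _ e)
    (continuous_densityU N).measurable.ennreal_ofReal (.of_forall fun θ => ?_)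
  simp only [densityU, dysonU_comp_perm]

theorem dysonSU_eq_complete {N : ℕ} (θ : Fin (N - 1) → ℝ) :
    dysonSU N θ = dysonU N (complete θ) := by
  refine dysonU_congr fun j => ?_
  by_cases h : (j : ℕ) < N - 1
  · simp only [complete, glue_of_lt _ _ _ h]
  · simp only [complete, glue_of_not_lt _ _ _ h, exp_wrap]

/-- The last index of `Fin N`. -/
def lastIndex {N : ℕ} (hN : 1 ≤ N) : Fin N := ⟨N - 1, by omega⟩

/-- The relation "sum ≡ 0 mod 2π" is symmetric: once θ_i is replaced by the dependent angle, the new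
dependent angle is the old θ_i. -/
theorem complete_exchange {N : ℕ} (hN : 1 ≤ N) (i : Fin (N - 1)) {θ : Fin (N - 1) → ℝ}
    (hθ : θ ∈ box (N - 1)) :
    (complete (exchange i θ) : Fin N → ℝ) =
      complete θ ∘ Equiv.swap (i.castLE (Nat.sub_le N 1)) (lastIndex hN) := by
  funext k
  rw [Function.comp_apply]
  by_cases h : (k : ℕ) < N - 1
  · rw [complete, glue_of_lt _ _ _ h]
    by_cases hi : k = i.castLE (Nat.sub_le N 1)
    · subst hi
      rw [Equiv.swap_apply_left, complete,
        glue_of_not_lt _ _ (lastIndex hN) (by simp [lastIndex])]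
      simp [exchange]
    · rw [Equiv.swap_apply_of_ne_of_ne hi (by rintro rfl; exact lt_irrefl _ h), complete,
        glue_of_lt _ _ _ h, exchange, Function.update_of_ne]
      rintro rfl
      exact hi rfl
  · obtain rfl : k = lastIndex hN := by ext; simp only [lastIndex]; omega
    rw [Equiv.swap_apply_right, complete, glue_of_not_lt _ _ _ h, complete,
      glue_of_lt _ _ _ (by simp)]
    have h1 : ∑ j, θ j = θ i + ∑ j ∈ Finset.univ \ {i}, θ j := by
      rw [← Finset.sum_sdiff (Finset.subset_univ {i}), Finset.sum_singleton, add_comm]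
    rw [exchange, Finset.sum_update_of_mem (Finset.mem_univ i), h1]
    exact wrap_sub_wrap_sub _ _ (hθ i trivial)

theorem measurable_comp_perm {N : ℕ} (e : Equiv.Perm (Fin N)) :
    Measurable fun θ : Fin N → ℝ => θ ∘ e :=
  measurable_pi_lambda _ fun i => measurable_pi_apply (e i)

theorem measurePreserving_lawSU_swap_last {N : ℕ} (hN : 1 ≤ N) (i : Fin (N - 1)) :
    MeasurePreserving (fun θ : Fin N → ℝ => θ ∘
        Equiv.swap (i.castLE (Nat.sub_le N 1)) (lastIndex hN)) (lawSU N) (lawSU N) := by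
  refine ⟨measurable_comp_perm _, ?_⟩
  have hbox : ∀ᵐ θ ∂(volume.restrict (box (N - 1))), θ ∈ box (N - 1) :=
    ae_restrict_mem (measurableSet_box _)
  have mp := measurePreserving_withDensity (measurePreserving_exchange i)
    (continuous_densitySU N).measurable.ennreal_ofReal (hbox.mono fun θ hθ => by
      simp only [densitySU, dysonSU_eq_complete, complete_exchange hN i hθ, dysonU_comp_perm])
  rw [lawSU_eq, Measure.map_map (measurable_comp_perm _) measurable_complete]
  conv_rhs => rw [← mp.map_eq, Measure.map_map measurable_complete mp.measurable]
  refine Measure.map_congr ?_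
  refine (withDensity_absolutelyContinuous _ _).ae_le (hbox.mono fun θ hθ => ?_)
  simp only [Function.comp_apply, complete_exchange hN i hθ]

/-- Transpositions with the last index generate all permutations. -/
theorem measurePreserving_lawSU {N : ℕ} (hN : 1 ≤ N) (e : Equiv.Perm (Fin N)) :
    MeasurePreserving (fun θ : Fin N → ℝ => θ ∘ e) (lawSU N) (lawSU N) := by
  have comp : ∀ {e f : Equiv.Perm (Fin N)},
      MeasurePreserving (fun θ : Fin N → ℝ => θ ∘ e) (lawSU N) (lawSU N) →
      MeasurePreserving (fun θ : Fin N → ℝ => θ ∘ f) (lawSU N) (lawSU N) →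
      MeasurePreserving (fun θ : Fin N → ℝ => θ ∘ (e * f : Equiv.Perm (Fin N)))
        (lawSU N) (lawSU N) := fun he hf => hf.comp he
  induction e using Equiv.Perm.swap_induction_on with
  | one => exact MeasurePreserving.id _
  | swap_mul f x y hxy hf =>
    refine comp ?_ hf
    have hl : ∀ z : Fin N, z ≠ lastIndex hN → MeasurePreserving (fun θ : Fin N → ℝ => θ ∘
        Equiv.swap z (lastIndex hN)) (lawSU N) (lawSU N) := fun z hz =>
      measurePreserving_lawSU_swap_last hN
        ⟨z, by have : (z : ℕ) ≠ N - 1 := fun h => hz (Fin.ext h); omega⟩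
    by_cases hx : x = lastIndex hN
    · subst hx
      rw [Equiv.swap_comm]
      exact hl y hxy.symm
    by_cases hy : y = lastIndex hN
    · subst hy
      exact hl x hx
    -- Conjugating (x last) by (y last) gives (x y).
    have := comp (comp (hl y hy) (hl x hx)) (hl y hy)
    rwa [Equiv.swap_comm y, Equiv.swap_mul_swap_mul_swap hx hxy, Equiv.swap_comm] at this

/-! ### Inclusion–exclusion for exchangeable laws. -/

/-- The product set with the factor `J` at the indices in `A` and `[-π, π)` elsewhere. -/
def pattern {N : ℕ} (A : Finset (Fin N)) (J : Set ℝ) : Set (Fin N → ℝ) :=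
  Set.univ.pi fun i => if i ∈ A then J else Set.Ico (-Real.pi) Real.pi

theorem measurableSet_pattern {N : ℕ} (A : Finset (Fin N)) {J : Set ℝ} (hJ : MeasurableSet J) :
    MeasurableSet (pattern A J) :=
  MeasurableSet.univ_pi fun i => by split_ifs; exacts [hJ, measurableSet_Ico]

theorem measureReal_pattern {N : ℕ} {μ : Measure (Fin N → ℝ)}
    (hμ : ∀ e : Equiv.Perm (Fin N), MeasurePreserving (fun θ : Fin N → ℝ => θ ∘ e) μ μ)
    (A : Finset (Fin N)) {J : Set ℝ} (hJ : MeasurableSet J) :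
    μ.real (pattern A J) = μ.real (cell N A.card J) := by
  have hA : A.card ≤ N := by simpa using A.card_le_univ
  have e : {i // i ∈ A} ≃ {i : Fin N // (i : ℕ) < A.card} := by
    refine Fintype.equivOfCardEq ?_
    rw [Fintype.card_coe, Fintype.card_subtype]
    simp [Fin.card_filter_val_lt, hA]
  have mp := hμ e.extendSubtype
  have : (fun θ : Fin N → ℝ => θ ∘ e.extendSubtype) ⁻¹' pattern A J = cell N A.card J := by
    ext θ
    simp only [Set.mem_preimage, pattern, cell, Set.mem_univ_pi, Function.comp_apply]
    conv_rhs => rw [e.extendSubtype.surjective.forall]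
    refine forall_congr' fun i => ?_
    by_cases hi : i ∈ A
    · rw [if_pos hi, if_pos (e.extendSubtype_mem i hi)]
    · rw [if_neg hi, if_neg (e.extendSubtype_not_mem i hi)]
  rw [← this, mp.measureReal_preimage (measurableSet_pattern A hJ).nullMeasurableSet]

theorem indicator_univ_pi_one {N : ℕ} (s : Fin N → Set ℝ) (θ : Fin N → ℝ) :
    (Set.univ.pi s).indicator (1 : (Fin N → ℝ) → ℝ) θ = ∏ i, (s i).indicator (1 : ℝ → ℝ) (θ i) := by
  classical
  simp only [Set.indicator_apply, Set.mem_univ_pi, Pi.one_apply]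
  rw [Finset.prod_ite_zero]
  simp

/-- Expand ∏ (1_{[-π, π)} − 1_J) over the indices ≥ k. By exchangeability a subset of size l
contributes the mass of the cell with k + l factors J, and C(N, k) C(N − k, l) = N! / (k! l! (N − k
− l)!). -/
theorem choose_mul_measureReal_region {N k : ℕ} (hk : k ≤ N) {μ : Measure (Fin N → ℝ)}
    [IsFiniteMeasure μ]
    (hμ : ∀ e : Equiv.Perm (Fin N), MeasurePreserving (fun θ : Fin N → ℝ => θ ∘ e) μ μ)
    {J : Set ℝ} (hJm : MeasurableSet J) (hJ : J ⊆ Set.Ico (-Real.pi) Real.pi) :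
    (N.choose k : ℝ) * μ.real (region N k J) = ∑ n ∈ Finset.Icc k N,
      (-1 : ℝ) ^ (n - k) / ((k.factorial : ℝ) * ((n - k).factorial : ℝ)) *
        ((N.factorial : ℝ) / ((N - n).factorial : ℝ) * μ.real (cell N n J)) := by
  classical
  set I := Set.Ico (-Real.pi) Real.pi
  set F : Finset (Fin N) := Finset.univ.filter fun i => (i : ℕ) < k with hF
  set G : Finset (Fin N) := Finset.univ.filter fun i => ¬ (i : ℕ) < k with hG
  have hFc : F.card = k := by simp [hF, Fin.card_filter_val_lt, hk]
  have hGc : G.card = N - k := by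
    have := Finset.card_filter_add_card_filter_not (s := (Finset.univ : Finset (Fin N)))
      (fun i => (i : ℕ) < k)
    simp only [Finset.card_univ, Fintype.card_fin] at this
    change F.card + G.card = N at this
    omega
  have hFG : Disjoint F G := Finset.disjoint_filter_filter_not _ _ _
  have hregion : MeasurableSet (region N k J) :=
    MeasurableSet.univ_pi fun i => by split_ifs; exacts [hJm, measurableSet_Ico.diff hJm]
  have hexp : ∀ θ, (region N k J).indicator (1 : (Fin N → ℝ) → ℝ) θ =
      ∑ S ∈ G.powerset, (-1 : ℝ) ^ S.card * (pattern (F ∪ S) J).indicator 1 θ := by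
    intro θ
    have hsplit : ∀ f : Fin N → ℝ, ∏ i, f i = (∏ i ∈ F, f i) * ∏ i ∈ G, f i := fun f =>
      (Finset.prod_filter_mul_prod_filter_not _ _ _).symm
    rw [region, indicator_univ_pi_one, hsplit]
    have h1 : ∏ i ∈ F, (if (i : ℕ) < k then J else I \ J).indicator (1 : ℝ → ℝ) (θ i) =
        ∏ i ∈ F, J.indicator 1 (θ i) := Finset.prod_congr rfl fun i hi => by
      rw [if_pos (Finset.mem_filter.1 hi).2]
    have h2 : ∏ i ∈ G, (if (i : ℕ) < k then J else I \ J).indicator (1 : ℝ → ℝ) (θ i) =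
        ∏ i ∈ G, (I.indicator 1 (θ i) - J.indicator 1 (θ i)) := Finset.prod_congr rfl fun i hi => by
      rw [if_neg (Finset.mem_filter.1 hi).2]
      by_cases hJi : θ i ∈ J
      · simp [hJi, hJ hJi]
      · simp [Set.indicator_apply, hJi]
    rw [h1, h2, Finset.prod_sub, Finset.mul_sum]
    refine Finset.sum_congr rfl fun S hS => ?_
    have hSG := Finset.mem_powerset.1 hS
    rw [pattern, indicator_univ_pi_one, hsplit, ← Finset.prod_sdiff hSG]
    have h3 : ∀ i ∈ F, (if i ∈ F ∪ S then J else I).indicator (1 : ℝ → ℝ) (θ i) =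
        J.indicator 1 (θ i) := fun i hi => by rw [if_pos (Finset.mem_union_left _ hi)]
    have h4 : ∀ i ∈ S, (if i ∈ F ∪ S then J else I).indicator (1 : ℝ → ℝ) (θ i) =
        J.indicator 1 (θ i) := fun i hi => by rw [if_pos (Finset.mem_union_right _ hi)]
    have h5 : ∀ i ∈ G \ S, (if i ∈ F ∪ S then J else I).indicator (1 : ℝ → ℝ) (θ i) =
        I.indicator 1 (θ i) := fun i hi => by
      rw [if_neg]
      rw [Finset.mem_union, not_or]
      exact ⟨Finset.disjoint_right.1 hFG (Finset.mem_sdiff.1 hi).1, (Finset.mem_sdiff.1 hi).2⟩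
    rw [Finset.prod_congr rfl h3, Finset.prod_congr rfl h4, Finset.prod_congr rfl h5]
    ring
  have hint : μ.real (region N k J) =
      ∑ S ∈ G.powerset, (-1 : ℝ) ^ S.card * μ.real (cell N (k + S.card) J) := by
    rw [← integral_indicator_one hregion, integral_congr_ae (.of_forall hexp), integral_finsetSum]
    · refine Finset.sum_congr rfl fun S hS => ?_
      rw [integral_const_mul, integral_indicator_one (measurableSet_pattern _ hJm),
        measureReal_pattern hμ _ hJm, Finset.card_union_of_disjoint
          (hFG.mono_right (Finset.mem_powerset.1 hS)), hFc]
    · intro S _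
      exact ((integrable_const (1 : ℝ)).indicator (measurableSet_pattern _ hJm)).const_mul _
  rw [hint, Finset.sum_powerset_apply_card fun l => (-1 : ℝ) ^ l * μ.real (cell N (k + l) J), hGc,
    show Finset.Icc k N = Finset.Ico k (N + 1) by ext; simp,
    Finset.sum_Ico_eq_sum_range, Nat.sub_add_comm hk, Finset.mul_sum]
  refine Finset.sum_congr rfl fun l hl => ?_
  have hl' : l ≤ N - k := Nat.lt_succ_iff.1 (Finset.mem_range.1 hl)
  rw [nsmul_eq_mul, Nat.cast_choose ℝ hk, Nat.cast_choose ℝ hl', Nat.add_sub_cancel_left,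
    ← Nat.sub_sub]
  have h1 : (k.factorial : ℝ) ≠ 0 := by positivity
  have h2 : ((N - k).factorial : ℝ) ≠ 0 := by positivity
  have h3 : ((N - k - l).factorial : ℝ) ≠ 0 := by positivity
  have h4 : (l.factorial : ℝ) ≠ 0 := by positivity
  field_simp

/-! ### Fourier expansion of the masses of cells. -/

/-- The Fourier integral `∫_A e^{idθ} dθ`. -/
noncomputable def coeff (A : Set ℝ) (d : ℤ) : ℂ := ∫ x in A, angleChar d x

theorem continuous_angleChar (d : ℤ) : Continuous (angleChar d) := by
  unfold angleChar; fun_prop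

/-- The factor `J` or `[-π, π)` of `cell N n J` at the index `j`. -/
def side (n : ℕ) (J : Set ℝ) (j : ℕ) : Set ℝ := if j < n then J else Set.Ico (-Real.pi) Real.pi

theorem integral_cell_prod {m n : ℕ} (J : Set ℝ) (d : Fin m → ℤ) :
    ∫ θ in cell m n J, ∏ j, angleChar (d j) (θ j) = ∏ j : Fin m, coeff (side n J j) (d j) := by
  rw [cell, volume_pi, Measure.restrict_pi_pi,
    integral_fintype_prod_eq_prod (f := fun j x => angleChar (d j) x)]
  rfl

theorem integral_cell_sum_prod {m n : ℕ} {ι : Type*} (s : Finset ι) {J : Set ℝ}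
    (hJ : J ⊆ Set.Ico (-Real.pi) Real.pi) (a : ι → ℂ) (d : ι → Fin m → ℤ) :
    ∫ θ in cell m n J, ∑ i ∈ s, a i * ∏ j, angleChar (d i j) (θ j) =
      ∑ i ∈ s, a i * ∏ j : Fin m, coeff (side n J j) (d i j) := by
  rw [integral_finsetSum]
  · exact Finset.sum_congr rfl fun i _ => by rw [integral_const_mul, integral_cell_prod]
  · intro i _
    refine Integrable.const_mul ?_ _
    refine integrableOn_of_subset_box ?_ (cell_subset_box m n hJ)
    exact continuous_finsetProd _ fun j _ =>
      (continuous_angleChar _).comp (continuous_apply j)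

/-- The sign `sgn σ sgn τ`. -/
def signs {N : ℕ} (p : Equiv.Perm (Fin N) × Equiv.Perm (Fin N)) : ℂ :=
  (Equiv.Perm.sign p.1 : ℤ) * (Equiv.Perm.sign p.2 : ℤ)

theorem dysonU_expansion_prod {N : ℕ} (θ : Fin N → ℝ) :
    (dysonU N θ : ℂ) = ∑ p : Equiv.Perm (Fin N) × Equiv.Perm (Fin N),
      signs p * ∏ j, angleChar (freq p.1 p.2 j) (θ j) := by
  rw [dysonU_expansion, Fintype.sum_prod_type]; rfl

theorem angleChar_neg_sum {m : ℕ} (d : ℤ) (θ : Fin m → ℝ) :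
    angleChar d (-∑ i, θ i) = ∏ i, angleChar (-d) (θ i) := by
  simp only [angleChar, ← Complex.exp_sum]
  congr 1
  push_cast
  rw [← Finset.mul_sum, ← Finset.mul_sum]
  ring

theorem angleChar_add (d e : ℤ) (x : ℝ) :
    angleChar (d + e) x = angleChar d x * angleChar e x := by
  simp only [angleChar, ← Complex.exp_add]
  congr 1; push_cast; ring

/-- At θ_N = −∑ θ_i the character of frequency d in θ_N splits into characters of frequency −d in
each of the other angles. -/
theorem dysonSU_expansion {N : ℕ} (hN : 1 ≤ N) (θ : Fin (N - 1) → ℝ) :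
    (dysonSU N θ : ℂ) = ∑ p : Equiv.Perm (Fin N) × Equiv.Perm (Fin N),
      signs p * ∏ j : Fin (N - 1), angleChar
        (freq p.1 p.2 (j.castLE (Nat.sub_le N 1)) - freq p.1 p.2 (lastIndex hN)) (θ j) := by
  rw [dysonSU, dysonU_expansion_prod]
  refine Finset.sum_congr rfl fun p _ => ?_
  congr 1
  rw [prod_fin_split_last hN]
  have h1 : ∀ j : Fin (N - 1), (glue θ (fun _ => -∑ i, θ i) : Fin N → ℝ)
      (j.castLE (Nat.sub_le N 1)) = θ j := fun j => by rw [glue_of_lt _ _ _ (by simp)]; rfl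
  rw [glue_of_not_lt _ _ ⟨N - 1, _⟩ (by simp), angleChar_neg_sum, ← Finset.prod_mul_distrib]
  refine Finset.prod_congr rfl fun j _ => ?_
  rw [h1, ← angleChar_add]; rfl

theorem lawU_real_cell_fourier {N n : ℕ} {J : Set ℝ} (hJm : MeasurableSet J)
    (hJ : J ⊆ Set.Ico (-Real.pi) Real.pi) :
    ((N.factorial : ℂ) * (2 * Real.pi) ^ N) * ((lawU N).real (cell N n J) : ℂ) =
      ∑ p : Equiv.Perm (Fin N) × Equiv.Perm (Fin N),
        signs p * ∏ j : Fin N, coeff (side n J j) (freq p.1 p.2 j) := by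
  rw [lawU_real (measurableSet_cell N n hJm) (cell_subset_box N n hJ), ← integral_complex_ofReal,
    ← integral_cell_sum_prod _ hJ, ← integral_const_mul]
  refine integral_congr_ae (.of_forall fun θ => ?_)
  simp only [densityU]
  rw [← dysonU_expansion_prod]
  have h1 : (N.factorial : ℂ) ≠ 0 := by exact_mod_cast N.factorial_ne_zero
  have h2 : (Real.pi : ℂ) ≠ 0 := by exact_mod_cast Real.pi_ne_zero
  push_cast
  field_simp

theorem lawSU_real_cell_fourier {N n : ℕ} (hN : 1 ≤ N) (hn : n < N) {J : Set ℝ}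
    (hJm : MeasurableSet J) (hJ : J ⊆ Set.Ico (-Real.pi) Real.pi) :
    ((N.factorial : ℂ) * (2 * Real.pi) ^ (N - 1)) * ((lawSU N).real (cell N n J) : ℂ) =
      ∑ p : Equiv.Perm (Fin N) × Equiv.Perm (Fin N),
        signs p * ∏ j : Fin (N - 1), coeff (side n J j)
          (freq p.1 p.2 (j.castLE (Nat.sub_le N 1)) - freq p.1 p.2 (lastIndex hN)) := by
  rw [lawSU_real_cell hn hJm hJ, ← integral_complex_ofReal,
    ← integral_cell_sum_prod _ hJ, ← integral_const_mul]
  refine integral_congr_ae (.of_forall fun θ => ?_)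
  simp only [densitySU]
  rw [← dysonSU_expansion]
  have h1 : (N.factorial : ℂ) ≠ 0 := by exact_mod_cast N.factorial_ne_zero
  have h2 : (Real.pi : ℂ) ≠ 0 := by exact_mod_cast Real.pi_ne_zero
  push_cast
  field_simp

theorem integral_angleChar {a b : ℝ} (hab : a ≤ b) {d : ℤ} (hd : d ≠ 0) :
    coeff (Set.Ico a b) d = (angleChar d b - angleChar d a) / (Complex.I * d) := by
  have hd' : (Complex.I * (d : ℂ)) ≠ 0 := mul_ne_zero Complex.I_ne_zero (by exact_mod_cast hd)
  rw [coeff, integral_Ico_eq_integral_Ioc, ← intervalIntegral.integral_of_le hab]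
  have := integral_exp_mul_complex (a := a) (b := b) hd'
  simp only [angleChar, ← mul_assoc]
  exact this

theorem coeff_full {d : ℤ} (hd : d ≠ 0) : coeff (Set.Ico (-Real.pi) Real.pi) d = 0 := by
  rw [integral_angleChar (by linarith [Real.pi_pos]) hd]
  have : angleChar d Real.pi = angleChar d (-Real.pi) :=
    Complex.exp_eq_exp_iff_exists_int.2 ⟨d, by push_cast; ring⟩
  rw [this, sub_self, zero_div]

theorem coeff_full_zero : coeff (Set.Ico (-Real.pi) Real.pi) 0 = 2 * Real.pi := by
  simp only [coeff, angleChar, Int.cast_zero, zero_mul, mul_zero, Complex.exp_zero]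
  rw [setIntegral_const, measureReal_def, Real.volume_Ico, ENNReal.toReal_ofReal]
  · simp; ring
  · linarith [Real.pi_pos]

theorem coeff_neg (A : Set ℝ) (d : ℤ) : coeff A (-d) = (starRingEnd ℂ) (coeff A d) := by
  rw [coeff, coeff, ← integral_conj]
  refine integral_congr_ae (.of_forall fun x => ?_)
  simp only [angleChar, ← Complex.exp_conj]
  congr 1
  simp

/-! ### Fourier integrals over the Gram interval. -/

theorem gramInterval_measurable (N : ℕ) : MeasurableSet (gramInterval N) := measurableSet_Ico

theorem gramInterval_subset {N : ℕ} (hN : 1 ≤ N) :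
    gramInterval N ⊆ Set.Ico (-Real.pi) Real.pi := by
  refine Set.Ico_subset_Ico_right ?_
  have : 2 * Real.pi / N ≤ 2 * Real.pi :=
    div_le_self Real.two_pi_pos.le (by exact_mod_cast hN)
  linarith

/-- The interval has midpoint −π + π/N, which gives the phase, and half-length π/N, which gives the
sine. -/
theorem coeff_gram {N : ℕ} (hN : 1 ≤ N) {d : ℤ} (hd : d ≠ 0) :
    coeff (gramInterval N) d = (-1) ^ d * Complex.exp (Complex.I * (Real.pi * d / N)) *
      ((2 * Real.sin (Real.pi * d / N) / d : ℝ) : ℂ) := by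
  have hN0 : (N : ℂ) ≠ 0 := by exact_mod_cast (by omega : N ≠ 0)
  have hd0 : (d : ℂ) ≠ 0 := by exact_mod_cast hd
  have hpos : (0 : ℝ) ≤ 2 * Real.pi / N := by positivity
  rw [gramInterval, integral_angleChar (by linarith) hd]
  have hm : (-1 : ℂ) ^ d = Complex.exp (Complex.I * (-(Real.pi * d))) := by
    rw [← Complex.exp_pi_mul_I, ← Complex.exp_int_mul]
    exact Complex.exp_eq_exp_iff_exists_int.2 ⟨d, by ring⟩
  push_cast
  rw [Complex.sin, hm]
  set w : ℂ := Complex.I * (Real.pi * d / N)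
  have e1 : angleChar d (-Real.pi + 2 * Real.pi / N) =
      Complex.exp (Complex.I * (-(Real.pi * d))) * (Complex.exp w * Complex.exp w) := by
    rw [← Complex.exp_add, ← Complex.exp_add, angleChar]
    congr 1; simp only [w]; push_cast; field_simp; ring
  have e2 : angleChar d (-Real.pi) =
      Complex.exp (Complex.I * (-(Real.pi * d))) * (Complex.exp w * Complex.exp (-w)) := by
    rw [← Complex.exp_add, ← Complex.exp_add, angleChar]
    congr 1; push_cast; ring
  rw [e1, e2, show (Real.pi * d / N : ℂ) * Complex.I = w by ring,
    show -(Real.pi * d / N : ℂ) * Complex.I = -w by ring]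
  field_simp
  rw [Complex.I_sq]
  ring

/-- The Gram interval is exactly one period of e^{iNθ}. This is the property of the interval that
makes the terms without a transposition vanish. -/
theorem coeff_gram_self {N : ℕ} (hN : 1 ≤ N) : coeff (gramInterval N) N = 0 := by
  have hN0 : (N : ℝ) ≠ 0 := by exact_mod_cast (by omega : N ≠ 0)
  rw [coeff_gram hN (by omega)]
  simp [hN0]

/-- The phases combine to (−1)^{d+e} e^{iπ(d+e)/N}, which is a sign when N divides d + e. -/
theorem coeff_gram_mul {N : ℕ} (hN : 1 ≤ N) {d e : ℤ} (hd : d ≠ 0) (he : e ≠ 0) (s : ℤ)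
    (h : d + e = s * N) : coeff (gramInterval N) d * coeff (gramInterval N) e =
      ((-1) ^ (s * N + s) * (4 * Real.sin (Real.pi * d / N) * Real.sin (Real.pi * e / N) / (d * e))
        : ℝ) := by
  have hN0 : (N : ℂ) ≠ 0 := by exact_mod_cast (by omega : N ≠ 0)
  rw [coeff_gram hN hd, coeff_gram hN he]
  have h1 : Complex.exp (Complex.I * (Real.pi * d / N)) * Complex.exp (Complex.I * (Real.pi * e / N))
      = (-1) ^ s := by
    rw [← Complex.exp_add, ← Complex.exp_pi_mul_I, ← Complex.exp_int_mul]
    congr 1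
    have : (d : ℂ) + e = s * N := by exact_mod_cast h
    field_simp
    linear_combination this
  have h2 : (-1 : ℂ) ^ d * (-1) ^ e = (-1) ^ (s * N) := by
    rw [← zpow_add₀ (by norm_num), h]
  calc _ = ((-1 : ℂ) ^ d * (-1) ^ e) * (Complex.exp (Complex.I * (Real.pi * d / N)) *
        Complex.exp (Complex.I * (Real.pi * e / N))) *
        (((2 * Real.sin (Real.pi * d / N) / d : ℝ) : ℂ) *
        ((2 * Real.sin (Real.pi * e / N) / e : ℝ) : ℂ)) := by ring
    _ = _ := by
      rw [h1, h2, ← zpow_add₀ (by norm_num)]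
      push_cast
      ring

/-! ### Which pairs of permutations survive. -/

theorem finRotate_pow_val {N : ℕ} (m : ℕ) (i : Fin N) :
    (((finRotate N) ^ m) i : ℕ) = (i + m) % N := by
  induction m with
  | zero => simp [Nat.mod_eq_of_lt i.2]
  | succ m ih =>
    rw [pow_succ', Equiv.Perm.mul_apply]
    obtain _ | N := N
    · exact i.elim0
    · rw [finRotate_apply, Fin.val_add, ih, Fin.val_one', ← Nat.add_mod, add_assoc]

theorem perm_eq_one_of_fixes {α : Type*} [DecidableEq α] {κ : Equiv.Perm α} {a : α}
    (h : ∀ j, j ≠ a → κ j = j) : κ = 1 := by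
  ext j
  by_cases hj : j = a
  · subst hj
    by_contra hne
    exact hne (κ.injective (h _ hne))
  · exact h j hj

theorem perm_eq_one_or_swap {α : Type*} [DecidableEq α] {κ : Equiv.Perm α} {a b : α}
    (h : ∀ j, j ≠ a → j ≠ b → κ j = j) : κ = 1 ∨ κ = Equiv.swap a b := by
  by_cases ha : κ a = a
  · refine .inl (perm_eq_one_of_fixes (a := b) fun j hj => ?_)
    by_cases hja : j = a
    · rw [hja, ha]
    · exact h j hja hj
  · have hb : κ a = b := by
      by_contra hne
      exact ha (κ.injective (h _ ha hne))
    refine .inr ?_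
    have : Equiv.swap a b * κ = 1 := perm_eq_one_of_fixes (a := b) fun j hj => by
      rw [Equiv.Perm.mul_apply]
      by_cases hja : j = a
      · rw [hja, hb, Equiv.swap_apply_right]
      · rw [h j hja hj, Equiv.swap_apply_of_ne_of_ne hja hj]
    rw [← mul_right_inj (Equiv.swap a b), this, Equiv.swap_mul_self]

/-- The frequency of `θ_j` relative to that of the last angle. -/
def relFreq {N : ℕ} (hN : 1 ≤ N) (p : Equiv.Perm (Fin N) × Equiv.Perm (Fin N)) (j : Fin N) : ℤ :=
  freq p.1 p.2 j - freq p.1 p.2 (lastIndex hN)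

/-- The contribution of a pair of permutations to the difference of the two laws on a cell. -/
noncomputable def pairTerm {N : ℕ} (hN : 1 ≤ N) (n : ℕ) (J : Set ℝ)
    (p : Equiv.Perm (Fin N) × Equiv.Perm (Fin N)) : ℂ :=
  signs p * ∏ j : Fin N, coeff (side n J j) (relFreq hN p j)

theorem freq_swap {N : ℕ} (p : Equiv.Perm (Fin N) × Equiv.Perm (Fin N)) (j : Fin N) :
    freq p.swap.1 p.swap.2 j = -freq p.1 p.2 j := by
  simp [freq]

theorem pairTerm_swap {N : ℕ} (hN : 1 ≤ N) (n : ℕ) (J : Set ℝ)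
    (p : Equiv.Perm (Fin N) × Equiv.Perm (Fin N)) :
    pairTerm hN n J p.swap = (starRingEnd ℂ) (pairTerm hN n J p) := by
  simp only [pairTerm, map_mul, map_prod, ← coeff_neg, relFreq, freq_swap]
  congr 1
  · simp [signs, mul_comm]
  · exact Finset.prod_congr rfl fun j _ => by congr 1; ring

/-- Because n < N, the last angle has full range. A pair with last frequency 0 contributes equally
to both laws; any other pair has a vanishing last factor for U(N). The normalisations differ by 2π,
which is the last factor of `pairTerm`. -/
theorem law_difference {N n : ℕ} (hN : 1 ≤ N) (hn : n < N) {J : Set ℝ} (hJm : MeasurableSet J)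
    (hJ : J ⊆ Set.Ico (-Real.pi) Real.pi) :
    ((N.factorial : ℂ) * (2 * Real.pi) ^ N) *
        (((lawSU N).real (cell N n J) - (lawU N).real (cell N n J) : ℝ) : ℂ) =
      ∑ p : Equiv.Perm (Fin N) × Equiv.Perm (Fin N),
        if freq p.1 p.2 (lastIndex hN) = 0 then 0 else pairTerm hN n J p := by
  have h2 : (2 * Real.pi : ℂ) ^ N = (2 * Real.pi) * (2 * Real.pi) ^ (N - 1) := by
    rw [← pow_succ', Nat.sub_add_cancel hN]
  rw [Complex.ofReal_sub, mul_sub, lawU_real_cell_fourier hJm hJ]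
  rw [show (N.factorial : ℂ) * (2 * Real.pi) ^ N * ((lawSU N).real (cell N n J) : ℂ) =
    (2 * Real.pi) * (((N.factorial : ℂ) * (2 * Real.pi) ^ (N - 1)) *
      ((lawSU N).real (cell N n J) : ℂ)) by rw [h2]; ring,
    lawSU_real_cell_fourier hN hn hJm hJ, Finset.mul_sum, ← Finset.sum_sub_distrib]
  refine Finset.sum_congr rfl fun p _ => ?_
  have hside : side n J (lastIndex hN : Fin N) = Set.Ico (-Real.pi) Real.pi :=
    if_neg (by simp only [lastIndex]; omega)
  have h3 : (2 * Real.pi) * (signs p * ∏ j : Fin (N - 1), coeff (side n J j)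
      (freq p.1 p.2 (j.castLE (Nat.sub_le N 1)) - freq p.1 p.2 (lastIndex hN))) =
      pairTerm hN n J p := by
    rw [pairTerm, prod_fin_split_last hN]
    have : coeff (side n J (lastIndex hN : Fin N)) (relFreq hN p (lastIndex hN)) =
        2 * Real.pi := by
      rw [relFreq, sub_self, hside, coeff_full_zero]
    change _ = signs p * (_ * coeff (side n J (lastIndex hN : Fin N)) (relFreq hN p (lastIndex hN)))
    rw [this]
    simp only [relFreq, Fin.val_castLE]
    ring
  rw [h3]
  split_ifs with h0
  · simp only [pairTerm, relFreq, h0, sub_zero, sub_self]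
  · rw [Finset.prod_eq_zero (Finset.mem_univ (lastIndex hN)) (by rw [hside, coeff_full h0]),
      mul_zero, sub_zero]

/-- Exchanging σ and τ negates every frequency and conjugates the term, so negative last frequencies
determine the positive ones. -/
theorem sum_pairTerm_eq_add_conj {N : ℕ} (hN : 1 ≤ N) (n : ℕ) (J : Set ℝ) :
    (∑ p : Equiv.Perm (Fin N) × Equiv.Perm (Fin N),
        if freq p.1 p.2 (lastIndex hN) = 0 then 0 else pairTerm hN n J p) =
      (∑ p : Equiv.Perm (Fin N) × Equiv.Perm (Fin N),
        if freq p.1 p.2 (lastIndex hN) < 0 then pairTerm hN n J p else 0) +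
      (starRingEnd ℂ) (∑ p : Equiv.Perm (Fin N) × Equiv.Perm (Fin N),
        if freq p.1 p.2 (lastIndex hN) < 0 then pairTerm hN n J p else 0) := by
  rw [map_sum, ← (Equiv.prodComm _ _).sum_comp fun p : Equiv.Perm (Fin N) × Equiv.Perm (Fin N) =>
    (starRingEnd ℂ) (if freq p.1 p.2 (lastIndex hN) < 0 then pairTerm hN n J p else 0),
    ← Finset.sum_add_distrib]
  refine Finset.sum_congr rfl fun p _ => ?_
  rw [Equiv.prodComm_apply, freq_swap, pairTerm_swap]
  rcases lt_trichotomy (freq p.1 p.2 (lastIndex hN)) 0 with h | h | h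
  · rw [if_neg h.ne, if_pos h, if_neg (by omega)]; simp
  · simp [h]
  · rw [if_neg h.ne', if_neg (by omega), if_pos (by omega)]; simp

theorem coeff_side_self {N : ℕ} (hN : 1 ≤ N) (n j : ℕ) :
    coeff (side n (gramInterval N) j) N = 0 := by
  rw [side]
  split_ifs
  exacts [coeff_gram_self hN, coeff_full (by omega)]

/-- The permutation `j ↦ σ_j + m mod N`. -/
def shifted {N : ℕ} (m : ℕ) (σ : Equiv.Perm (Fin N)) : Equiv.Perm (Fin N) := finRotate N ^ m * σ

theorem shifted_val {N : ℕ} (m : ℕ) (σ : Equiv.Perm (Fin N)) (j : Fin N) :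
    (shifted m σ j : ℕ) = (σ j + m) % N := finRotate_pow_val m (σ j)

/-- Where σ takes the value N − 1, the shift wraps to m − 1: the frequency is N − m and the relative
frequency N, at which the Fourier integral vanishes over either kind of side. -/
theorem pairTerm_shifted {N : ℕ} (hN : 1 ≤ N) {n m : ℕ} (hm : 0 < m) (hmN : m < N)
    {σ : Equiv.Perm (Fin N)} (hl : freq σ (shifted m σ) (lastIndex hN) = -(m : ℤ)) :
    pairTerm hN n (gramInterval N) (σ, shifted m σ) = 0 := by
  rw [pairTerm, Finset.prod_eq_zero (Finset.mem_univ (σ.symm (lastIndex hN))), mul_zero]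
  have : relFreq hN (σ, shifted m σ) (σ.symm (lastIndex hN)) = N := by
    rw [relFreq, hl, freq, shifted_val, Equiv.apply_symm_apply]
    have : ((lastIndex hN : Fin N) : ℕ) = N - 1 := rfl
    rw [this, show N - 1 + m = m - 1 + N by omega, Nat.add_mod_right, Nat.mod_eq_of_lt (by omega)]
    omega
  rw [this, coeff_side_self hN]

/-- In a non-vanishing term all the angles of full range have the same frequency `-m`. -/
theorem exists_shift_of_pairTerm_ne_zero {N : ℕ} (hN : 1 ≤ N) {n : ℕ} {J : Set ℝ}
    {σ τ : Equiv.Perm (Fin N)} (hneg : freq σ τ (lastIndex hN) < 0)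
    (h : pairTerm hN n J (σ, τ) ≠ 0) :
    ∃ m : ℕ, 0 < m ∧ m < N ∧ freq σ τ (lastIndex hN) = -(m : ℤ) ∧
      (∀ j : Fin N, n ≤ j → (σ j : ℕ) + m < N) ∧
      ∀ j : Fin N, n ≤ j → ((shifted m σ)⁻¹ * τ) j = j := by
  obtain ⟨m, hm⟩ : ∃ m : ℕ, freq σ τ (lastIndex hN) = -(m : ℤ) :=
    ⟨(-freq σ τ (lastIndex hN)).toNat, by omega⟩
  -- Otherwise a full-circle integral at nonzero relative frequency is a factor of the term.
  have hj : ∀ j : Fin N, n ≤ j → (τ j : ℕ) = σ j + m := by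
    intro j hnj
    by_contra hne
    apply h
    rw [pairTerm, Finset.prod_eq_zero (Finset.mem_univ j), mul_zero]
    rw [side, if_neg (by omega), coeff_full]
    rw [relFreq, hm, freq]
    dsimp only
    omega
  have hlt : ∀ j : Fin N, n ≤ j → (σ j : ℕ) + m < N := fun j hnj => hj j hnj ▸ (τ j).2
  refine ⟨m, by omega, ?_, hm, hlt, fun j hnj => ?_⟩
  · rw [freq] at hm
    have := (τ (lastIndex hN)).2
    omega
  · rw [Equiv.Perm.mul_apply, Equiv.Perm.inv_eq_iff_eq]
    ext
    rw [shifted_val, hj j hnj, Nat.mod_eq_of_lt (hlt j hnj)]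

/-- A permutation fixing all indices but at most one is the identity, so every candidate pair is a
pure shift. The case n = 0 compares total masses. -/
theorem law_difference_gram_eq_zero {N n : ℕ} (hn : n < N) (hn1 : n ≤ 1) :
    (lawSU N).real (cell N n (gramInterval N)) = (lawU N).real (cell N n (gramInterval N)) := by
  have hN : 1 ≤ N := by omega
  have hz : (∑ p : Equiv.Perm (Fin N) × Equiv.Perm (Fin N),
      if freq p.1 p.2 (lastIndex hN) < 0 then pairTerm hN n (gramInterval N) p else 0) = 0 := by
    refine Finset.sum_eq_zero fun ⟨σ, τ⟩ _ => ?_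
    split_ifs with hneg
    · by_contra h
      obtain ⟨m, hm0, hmN, hm, -, hfix⟩ := exists_shift_of_pairTerm_ne_zero hN hneg h
      have h1 : (shifted m σ)⁻¹ * τ = 1 := perm_eq_one_of_fixes (a := ⟨0, hN⟩) fun j hj =>
        hfix j (hn1.trans (Nat.one_le_iff_ne_zero.2 fun h0 => hj (Fin.ext h0)))
      obtain rfl : shifted m σ = τ := inv_mul_eq_one.1 h1
      exact h (pairTerm_shifted hN hm0 hmN hm)
    · rfl
  have h := law_difference hN hn (gramInterval_measurable N) (gramInterval_subset hN)
  rw [sum_pairTerm_eq_add_conj, hz, map_zero, add_zero] at h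
  have h1 : (N.factorial : ℂ) * (2 * Real.pi) ^ N ≠ 0 :=
    mul_ne_zero (by exact_mod_cast N.factorial_ne_zero)
      (pow_ne_zero _ (by exact_mod_cast Real.two_pi_pos.ne'))
  have h2 := (mul_eq_zero.1 h).resolve_left h1
  exact sub_eq_zero.1 (Complex.ofReal_eq_zero.1 h2)

/-! ### The two-point term: shifts combined with a transposition. -/

theorem sum_perm_apply_two {M : Type*} [AddCommMonoid M] {N : ℕ} (hN : 2 ≤ N)
    (g : Fin N → Fin N → M) :
    ∑ σ : Equiv.Perm (Fin N), g (σ ⟨0, by omega⟩) (σ ⟨1, by omega⟩) =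
      (N - 2).factorial • ∑ p, ∑ q, if p = q then 0 else g p q := by
  obtain ⟨n, rfl⟩ := Nat.exists_eq_add_of_le' hN
  have h0 : (⟨0, by omega⟩ : Fin (n + 2)) = 0 := rfl
  have h1 : (⟨1, by omega⟩ : Fin (n + 2)) = 1 := rfl
  rw [h0, h1, ← Equiv.Perm.decomposeFin.symm.sum_comp, Fintype.sum_prod_type, Finset.smul_sum]
  refine Finset.sum_congr rfl fun p _ => ?_
  simp only [Equiv.Perm.decomposeFin_symm_apply_zero, Equiv.Perm.decomposeFin_symm_apply_one]
  rw [← Equiv.Perm.decomposeFin.symm.sum_comp, Fintype.sum_prod_type]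
  simp only [Equiv.Perm.decomposeFin_symm_apply_zero]
  have hR : (∑ q, if p = q then 0 else g p q) =
      ∑ q : Fin (n + 1), g p (Equiv.swap 0 p q.succ) := by
    rw [← (Equiv.swap 0 p).sum_comp _ _ (by simp), Fin.sum_univ_succ]
    simp only [Equiv.swap_apply_left, if_true, zero_add]
    refine Finset.sum_congr rfl fun q _ => ?_
    rw [if_neg]
    intro h
    have := congrArg (Equiv.swap 0 p) h
    rw [Equiv.swap_apply_right, Equiv.swap_apply_self] at this
    exact Fin.succ_ne_zero q this.symm
  rw [hR, Finset.smul_sum]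
  simp [Fintype.card_perm]

/-- The product of the two Fourier integrals over `J` in the term of
`(σ, shifted m σ * swap 0 1)` with `p = σ_0`, `q = σ_1`. -/
noncomputable def twoCoeff (N m : ℕ) (J : Set ℝ) (p q : ℕ) : ℂ :=
  coeff J ((p : ℤ) - ((q + m) % N : ℕ) + m) * coeff J ((q : ℤ) - ((p + m) % N : ℕ) + m)

theorem twoCoeff_comm (N m : ℕ) (J : Set ℝ) (p q : ℕ) :
    twoCoeff N m J p q = twoCoeff N m J q p := mul_comm _ _

/-- All indices that overflow under a shift by `m` are `p` or `q`. -/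
def Overflow {N : ℕ} (m : ℕ) (p q : Fin N) : Prop :=
  ∀ a : Fin N, N ≤ a + m → a = p ∨ a = q

instance {N : ℕ} (m : ℕ) (p q : Fin N) : Decidable (Overflow m p q) := by
  unfold Overflow; infer_instance

/-- The shift is the m-th power of an N-cycle, of sign (−1)^{(N−1)m}, and the transposition adds a
minus. No full-range index overflows, so each of those N − 2 angles has relative frequency 0 and
gives 2π. -/
theorem pairTerm_shifted_swap {N : ℕ} (hN : 3 ≤ N) {m : ℕ} (hm : m ≠ 0) {J : Set ℝ}
    {σ : Equiv.Perm (Fin N)}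
    (hσ : Overflow m (σ ⟨0, by omega⟩) (σ ⟨1, by omega⟩)) :
    (if freq σ (shifted m σ * Equiv.swap ⟨0, by omega⟩ ⟨1, by omega⟩)
        (lastIndex (N := N) (by omega)) < 0
      then pairTerm (by omega) 2 J
        (σ, shifted m σ * Equiv.swap ⟨0, by omega⟩ ⟨1, by omega⟩) else 0) =
      -((-1) ^ ((N - 1) * m) * (2 * Real.pi) ^ (N - 2) *
        twoCoeff N m J (σ ⟨0, by omega⟩) (σ ⟨1, by omega⟩)) := by
  set τ := shifted m σ * Equiv.swap ⟨0, by omega⟩ ⟨1, by omega⟩ with hτ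
  have hτj : ∀ j : Fin N, 2 ≤ (j : ℕ) → (τ j : ℕ) = σ j + m := by
    intro j hj
    have hlt : (σ j : ℕ) + m < N := by
      by_contra hge
      rcases hσ (σ j) (by omega) with h | h
      · have := congrArg Fin.val (σ.injective h); simp only at this; omega
      · have := congrArg Fin.val (σ.injective h); simp only at this; omega
    rw [hτ, Equiv.Perm.mul_apply, Equiv.swap_apply_of_ne_of_ne, shifted_val, Nat.mod_eq_of_lt hlt]
    · intro h; rw [h] at hj; simp at hj
    · intro h; rw [h] at hj; simp at hj
  have hfreq : ∀ j : Fin N, 2 ≤ (j : ℕ) → freq σ τ j = -(m : ℤ) := fun j hj => by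
    rw [freq, hτj j hj]; push_cast; ring
  have hl : freq σ τ (lastIndex (N := N) (by omega)) = -(m : ℤ) :=
    hfreq _ (by simp only [lastIndex]; omega)
  have h0 : (τ ⟨0, by omega⟩ : ℕ) = (σ ⟨1, by omega⟩ + m) % N := by
    rw [hτ, Equiv.Perm.mul_apply, Equiv.swap_apply_left, shifted_val]
  have h1 : (τ ⟨1, by omega⟩ : ℕ) = (σ ⟨0, by omega⟩ + m) % N := by
    rw [hτ, Equiv.Perm.mul_apply, Equiv.swap_apply_right, shifted_val]
  have hsign : signs (σ, τ) = -(-1) ^ ((N - 1) * m) := by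
    have hs : Equiv.Perm.sign σ * Equiv.Perm.sign τ = -(-1) ^ ((N - 1) * m) := by
      rw [hτ, shifted, map_mul, map_mul, map_pow, sign_finRotate, Equiv.Perm.sign_swap (by simp),
        ← pow_mul, mul_neg_one, mul_neg, mul_left_comm, Int.units_mul_self, mul_one]
    have := congrArg (fun u : ℤˣ => ((u : ℤ) : ℂ)) hs
    simpa [signs] using this
  rw [if_pos (by omega), pairTerm, hsign, prod_fin_split (n := 2) (by omega : 2 ≤ N),
    Fin.prod_univ_two]
  have hrest : ∀ j : Fin (N - 2), coeff (side 2 J ((⟨2 + j, by omega⟩ : Fin N) : ℕ))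
      (relFreq (by omega) (σ, τ) ⟨2 + j, by omega⟩) = 2 * Real.pi := fun j => by
    rw [side, if_neg (by simp only; omega), relFreq, hl, hfreq _ (by simp only; omega), sub_self, coeff_full_zero]
  rw [Finset.prod_congr rfl fun j _ => hrest j, Finset.prod_const, Finset.card_univ,
    Fintype.card_fin]
  have e0 : relFreq (by omega) (σ, τ) (Fin.castLE (by omega : 2 ≤ N) 0) =
      (σ ⟨0, by omega⟩ : ℤ) - ((σ ⟨1, by omega⟩ + m) % N : ℕ) + m := by
    have : (Fin.castLE (by omega : 2 ≤ N) 0) = ⟨0, by omega⟩ := rfl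
    rw [relFreq, hl, this, freq, h0]; ring
  have e1 : relFreq (by omega) (σ, τ) (Fin.castLE (by omega : 2 ≤ N) 1) =
      (σ ⟨1, by omega⟩ : ℤ) - ((σ ⟨0, by omega⟩ + m) % N : ℕ) + m := by
    have : (Fin.castLE (by omega : 2 ≤ N) 1) = ⟨1, by omega⟩ := rfl
    rw [relFreq, hl, this, freq, h1]; ring
  rw [e0, e1, twoCoeff, side, side, if_pos (by simp), if_pos (by simp)]
  ring

/-- For m ≥ 3 the values N − 1, N − 2, N − 3 all overflow, too many for two slots. -/
theorem Overflow.le_two {N : ℕ} (hN : 3 ≤ N) {m : ℕ} {p q : Fin N} (h : Overflow m p q) :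
    m ≤ 2 := by
  by_contra hm
  have h1 := h ⟨N - 1, by omega⟩ (by simp only; omega)
  have h2 := h ⟨N - 2, by omega⟩ (by simp only; omega)
  have h3 := h ⟨N - 3, by omega⟩ (by simp only; omega)
  simp only [Fin.ext_iff] at h1 h2 h3
  omega

theorem sum_pairTerm_right {N : ℕ} (hN : 3 ≤ N) (σ : Equiv.Perm (Fin N)) :
    (∑ τ : Equiv.Perm (Fin N), if freq σ τ (lastIndex (N := N) (by omega)) < 0
      then pairTerm (by omega) 2 (gramInterval N) (σ, τ) else 0) =
    ∑ m ∈ {1, 2}, if Overflow m (σ ⟨0, by omega⟩) (σ ⟨1, by omega⟩) then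
      -((-1) ^ ((N - 1) * m) * (2 * Real.pi) ^ (N - 2) *
        twoCoeff N m (gramInterval N) (σ ⟨0, by omega⟩) (σ ⟨1, by omega⟩)) else 0 := by
  conv_rhs => rw [← Finset.sum_filter]
  symm
  refine Finset.sum_of_injOn
    (fun m => shifted m σ * Equiv.swap ⟨0, by omega⟩ ⟨1, by omega⟩) ?_ (fun _ _ => by simp) ?_ ?_
  · intro m hm m' hm' h
    -- The shift sends the value 0 to m, as m ≤ 2 < N, so m can be read off.
    have h' := congrArg (fun f : Equiv.Perm (Fin N) => (f (σ.symm ⟨0, by omega⟩) : ℕ))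
      (mul_right_cancel h)
    simp only [shifted_val, Equiv.apply_symm_apply, zero_add] at h'
    simp only [Finset.mem_coe, Finset.mem_filter, Finset.mem_insert, Finset.mem_singleton]
      at hm hm'
    rwa [Nat.mod_eq_of_lt (by omega), Nat.mod_eq_of_lt (by omega)] at h'
  · intro τ _ hτ
    split_ifs with hneg
    · by_contra h
      obtain ⟨m, hm0, hmN, hm, hlt, hfix⟩ := exists_shift_of_pairTerm_ne_zero (by omega) hneg h
      have hκ := perm_eq_one_or_swap (κ := (shifted m σ)⁻¹ * τ) (a := ⟨0, by omega⟩)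
        (b := ⟨1, by omega⟩) fun j hj0 hj1 => hfix j (by
          simp only [ne_eq, Fin.ext_iff] at hj0 hj1; omega)
      rcases hκ with hκ | hκ
      · obtain rfl : shifted m σ = τ := inv_mul_eq_one.1 hκ
        exact h (pairTerm_shifted _ hm0 hmN hm)
      · have hov : Overflow m (σ ⟨0, by omega⟩) (σ ⟨1, by omega⟩) := by
          intro a ha
          obtain ⟨j, rfl⟩ := σ.surjective a
          have : ¬ 2 ≤ (j : ℕ) := fun hj => by have := hlt j hj; omega
          obtain hj | hj : (j : ℕ) = 0 ∨ (j : ℕ) = 1 := by omega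
          · left; congr 1; exact Fin.ext hj
          · right; congr 1; exact Fin.ext hj
        refine hτ ⟨m, ?_, (inv_mul_eq_iff_eq_mul.1 hκ).symm⟩
        have := hov.le_two hN
        simp only [Finset.mem_coe, Finset.mem_filter, Finset.mem_insert, Finset.mem_singleton]
        exact ⟨by omega, hov⟩
    · rfl
  · intro m hm
    simp only [Finset.mem_filter, Finset.mem_insert, Finset.mem_singleton] at hm
    exact (pairTerm_shifted_swap hN (by omega) hm.2).symm

/-- Only N − 1 overflows, so it is p or q, whence the factor 2. The other entry is the summation
index k, and the two frequencies add up to N. -/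
theorem sum_overflow_one {N : ℕ} (hN : 3 ≤ N) (J : Set ℝ) :
    (∑ p : Fin N, ∑ q : Fin N, if p = q then 0 else
      if Overflow 1 p q then twoCoeff N 1 J p q else 0) =
      2 * ∑ k : Fin (N - 1), coeff J ((N : ℤ) - 1 - (k : ℕ)) * coeff J ((k : ℕ) + 1) := by
  set l : Fin N := lastIndex (by omega) with hl
  have hlv : (l : ℕ) = N - 1 := rfl
  have hov : ∀ p q : Fin N, Overflow 1 p q ↔ l = p ∨ l = q := fun p q =>
    ⟨fun h => h l (by omega), fun h a ha => by
      obtain rfl : a = l := Fin.ext (by omega)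
      exact h⟩
  have hsplit : ∀ p q : Fin N, (if p = q then 0 else
      if Overflow 1 p q then twoCoeff N 1 J p q else 0) =
      (if p = l then (if q = l then 0 else twoCoeff N 1 J l q) else 0) +
      (if q = l then (if p = l then 0 else twoCoeff N 1 J l p) else 0) := by
    intro p q
    simp only [hov]
    by_cases hp : p = l
    · by_cases hq : q = l
      · simp [hp, hq]
      · have : l ≠ q := Ne.symm hq
        simp [hp, hq, this]
    · by_cases hq : q = l
      · simp [hp, hq, twoCoeff_comm]
      · have h1 : l ≠ q := Ne.symm hq
        have h2 : l ≠ p := Ne.symm hp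
        simp [hp, hq, h1, h2]
  have hsum : (∑ q : Fin N, if q = l then 0 else twoCoeff N 1 J l q) =
      ∑ k : Fin (N - 1), coeff J ((N : ℤ) - 1 - (k : ℕ)) * coeff J ((k : ℕ) + 1) := by
    rw [sum_fin_split_last (by omega : 1 ≤ N)]
    have hll : (⟨N - 1, by omega⟩ : Fin N) = l := rfl
    rw [if_pos hll, add_zero]
    refine Finset.sum_congr rfl fun k _ => ?_
    have hk := k.2
    rw [if_neg (fun h => by have := congrArg Fin.val h; simp only [Fin.val_castLE] at this; omega),
      twoCoeff, hlv, Fin.val_castLE, Nat.mod_eq_of_lt (by omega : (k : ℕ) + 1 < N),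
      Nat.sub_add_cancel (by omega : 1 ≤ N), Nat.mod_self]
    congr 2
    · omega
  simp only [hsplit, Finset.sum_add_distrib]
  rw [Finset.sum_comm (f := fun p q : Fin N =>
    if q = l then (if p = l then 0 else twoCoeff N 1 J l p) else 0)]
  have hin : ∀ f : Fin N → ℂ, (∑ p : Fin N, ∑ q : Fin N, if p = l then f q else 0) = ∑ q, f q :=
    fun f => by rw [Finset.sum_comm]; simp
  rw [hin, hsum, two_mul]

/-- Both N − 1 and N − 2 overflow, so they are p and q in one of two orders; the frequencies add up
to 2N. -/
theorem sum_overflow_two {N : ℕ} (hN : 3 ≤ N) (J : Set ℝ) :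
    (∑ p : Fin N, ∑ q : Fin N, if p = q then 0 else
      if Overflow 2 p q then twoCoeff N 2 J p q else 0) =
      2 * (coeff J ((N : ℤ) + 1) * coeff J ((N : ℤ) - 1)) := by
  set l : Fin N := ⟨N - 1, by omega⟩ with hl
  set k : Fin N := ⟨N - 2, by omega⟩ with hk
  have hlv : (l : ℕ) = N - 1 := rfl
  have hkv : (k : ℕ) = N - 2 := rfl
  have hlk : l ≠ k := fun h => by have := congrArg Fin.val h; omega
  have hsplit : ∀ p q : Fin N, (if p = q then 0 else
      if Overflow 2 p q then twoCoeff N 2 J p q else 0) =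
      (if p = l then (if q = k then twoCoeff N 2 J l k else 0) else 0) +
      (if p = k then (if q = l then twoCoeff N 2 J l k else 0) else 0) := by
    intro p q
    by_cases hov : Overflow 2 p q
    · have h1 := hov l (by omega)
      have h2 := hov k (by omega)
      rw [if_pos hov]
      rcases h1 with rfl | rfl
      · obtain rfl := h2.resolve_left hlk.symm
        simp [hlk]
      · obtain rfl := h2.resolve_right hlk.symm
        simp [hlk.symm, twoCoeff_comm]
    · rw [if_neg hov]
      have h1 : ¬ (p = l ∧ q = k) := by
        rintro ⟨rfl, rfl⟩
        refine hov fun a ha => ?_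
        simp only [Fin.ext_iff]; omega
      have h2 : ¬ (p = k ∧ q = l) := by
        rintro ⟨rfl, rfl⟩
        refine hov fun a ha => ?_
        simp only [Fin.ext_iff]; omega
      rw [← ite_and, ← ite_and, if_neg h1, if_neg h2]
      simp
  have hv : twoCoeff N 2 J l k = coeff J ((N : ℤ) + 1) * coeff J ((N : ℤ) - 1) := by
    rw [twoCoeff, hlv, hkv, show N - 2 + 2 = N by omega, Nat.mod_self,
      show N - 1 + 2 = 1 + N by omega, Nat.add_mod_right, Nat.mod_eq_of_lt (by omega)]
    congr 2 <;> omega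
  simp only [hsplit, Finset.sum_add_distrib]
  simp [hv, two_mul]

theorem coeff_gram_mul_one {N : ℕ} (hN : 1 ≤ N) (k : Fin (N - 1)) :
    coeff (gramInterval N) ((N : ℤ) - 1 - (k : ℕ)) * coeff (gramInterval N) ((k : ℕ) + 1) =
      (-(-1) ^ N * (4 * (1 / (((k : ℕ) + 1 : ℕ) * (N - ((k : ℕ) + 1) : ℕ)) *
        Real.sin (((k : ℕ) + 1 : ℕ) * Real.pi / N) *
        Real.sin ((N - ((k : ℕ) + 1) : ℕ) * Real.pi / N))) : ℝ) := by
  have hk := k.2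
  rw [coeff_gram_mul hN (by omega) (by omega) 1 (by ring)]
  have e : ((N - ((k : ℕ) + 1) : ℕ) : ℝ) = N - 1 - (k : ℕ) := by
    rw [Nat.cast_sub (by omega)]; push_cast; ring
  rw [e]
  congr 1
  rw [zpow_add₀ (by norm_num), one_mul, zpow_natCast]
  push_cast
  rw [mul_comm Real.pi, mul_comm Real.pi, one_div, mul_comm ((k : ℝ) + 1)]
  ring

theorem coeff_gram_mul_two {N : ℕ} (hN : 2 ≤ N) :
    coeff (gramInterval N) ((N : ℤ) + 1) * coeff (gramInterval N) ((N : ℤ) - 1) =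
      (-(4 * (1 / ((N : ℝ) ^ 2 - 1) * Real.sin (Real.pi / N) ^ 2)) : ℝ) := by
  have hN0 : (N : ℝ) ≠ 0 := by exact_mod_cast (by omega : N ≠ 0)
  rw [coeff_gram_mul (by omega) (by omega) (by omega) 2 (by ring)]
  congr 1
  have h1 : Real.sin (Real.pi * ((N : ℤ) + 1 : ℤ) / N) = -Real.sin (Real.pi / N) := by
    rw [show Real.pi * ((N : ℤ) + 1 : ℤ) / N = Real.pi / N + Real.pi by
      push_cast; field_simp; ring, Real.sin_add_pi]
  have h2 : Real.sin (Real.pi * ((N : ℤ) - 1 : ℤ) / N) = Real.sin (Real.pi / N) := by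
    rw [show Real.pi * ((N : ℤ) - 1 : ℤ) / N = Real.pi - Real.pi / N by
      push_cast; field_simp, Real.sin_pi_sub]
  have h3 : (-1 : ℝ) ^ (2 * (N : ℤ) + 2) = 1 := Even.neg_one_zpow ⟨N + 1, by ring⟩
  rw [h1, h2, h3]
  push_cast
  rw [show ((N : ℝ) + 1) * (N - 1) = (N : ℝ) ^ 2 - 1 by ring]
  ring

/-- The sum over `k₁ + k₂ = N` of `sin(k₁π/N) sin(k₂π/N) / (k₁k₂)`. -/
noncomputable def sineSum (N : ℕ) : ℝ := ∑ k : Fin (N - 1),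
  1 / (((k : ℕ) + 1 : ℕ) * (N - ((k : ℕ) + 1) : ℕ)) *
    Real.sin (((k : ℕ) + 1 : ℕ) * Real.pi / N) * Real.sin ((N - ((k : ℕ) + 1) : ℕ) * Real.pi / N)

/-- The 8 is two orders of (p, q) times the two factors 2 in the Fourier integrals; the parity signs
cancel. -/
theorem sum_pairTerm_two {N : ℕ} (hN : 3 ≤ N) :
    (∑ p : Equiv.Perm (Fin N) × Equiv.Perm (Fin N),
      if freq p.1 p.2 (lastIndex (N := N) (by omega)) < 0
        then pairTerm (by omega) 2 (gramInterval N) p else 0) =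
      ((2 * Real.pi) ^ (N - 2) * (N - 2).factorial * (8 *
        (1 / ((N : ℝ) ^ 2 - 1) * Real.sin (Real.pi / N) ^ 2 - sineSum N)) : ℝ) := by
  rw [Fintype.sum_prod_type]
  simp only [sum_pairTerm_right hN]
  rw [Finset.sum_comm]
  have key : ∀ m : ℕ, (∑ σ : Equiv.Perm (Fin N),
      if Overflow m (σ ⟨0, by omega⟩) (σ ⟨1, by omega⟩) then
      -((-1) ^ ((N - 1) * m) * (2 * Real.pi) ^ (N - 2) *
        twoCoeff N m (gramInterval N) (σ ⟨0, by omega⟩) (σ ⟨1, by omega⟩)) else 0) =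
      -((-1) ^ ((N - 1) * m) * (2 * Real.pi) ^ (N - 2) * (N - 2).factorial *
        ∑ p : Fin N, ∑ q : Fin N, if p = q then 0 else
          if Overflow m p q then twoCoeff N m (gramInterval N) p q else 0) := by
    intro m
    have h := sum_perm_apply_two (by omega : 2 ≤ N) fun p q : Fin N =>
      if Overflow m p q then twoCoeff N m (gramInterval N) p q else 0
    rw [nsmul_eq_mul] at h
    rw [mul_assoc (_ * _) ((N - 2).factorial : ℂ), ← h, Finset.mul_sum, ← Finset.sum_neg_distrib]
    refine Finset.sum_congr rfl fun σ _ => ?_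
    split_ifs
    · rfl
    · simp
  rw [Finset.sum_pair (by norm_num), key, key, sum_overflow_one hN, sum_overflow_two hN,
    coeff_gram_mul_two (by omega)]
  simp only [coeff_gram_mul_one (by omega : 1 ≤ N)]
  rw [← Complex.ofReal_sum, ← Finset.mul_sum, ← Finset.mul_sum]
  change _ = (((2 * Real.pi) ^ (N - 2) * (N - 2).factorial * (8 *
        (1 / ((N : ℝ) ^ 2 - 1) * Real.sin (Real.pi / N) ^ 2 - sineSum N)) : ℝ) : ℂ)
  rw [← sineSum]
  have hs : (-1 : ℂ) ^ ((N - 1) * 2) = 1 := by rw [mul_comm, pow_mul]; simp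
  have hs1 : (-1 : ℂ) ^ N = -(-1) ^ (N - 1) := by
    conv_lhs => rw [← Nat.sub_add_cancel (by omega : 1 ≤ N), pow_succ]
    ring
  have hs2 : (-1 : ℂ) ^ (N - 1) * (-1) ^ (N - 1) = 1 := by
    rw [← pow_add, ← two_mul, pow_mul]; simp
  rw [hs, mul_one]
  push_cast
  rw [hs1]
  linear_combination (-8 * (2 * (Real.pi : ℂ)) ^ (N - 2) * (N - 2).factorial * (sineSum N : ℂ)) * hs2

theorem integralX_two {N : ℕ} (hN : 3 ≤ N) :
    integralX N 2 (gramInterval N) = 4 / Real.pi ^ 2 *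
      (1 / ((N : ℝ) ^ 2 - 1) * Real.sin (Real.pi / N) ^ 2 - sineSum N) := by
  rw [integralX_eq two_ne_zero (by omega) (gramInterval_measurable N)
    (gramInterval_subset (by omega))]
  have h := law_difference (n := 2) (by omega : 1 ≤ N) (by omega) (gramInterval_measurable N)
    (gramInterval_subset (by omega))
  -- The sum is real, so its conjugate doubles it; 2 · 8 / (2π)² is the final constant 4/π².
  rw [sum_pairTerm_eq_add_conj, sum_pairTerm_two hN, Complex.conj_ofReal] at h
  have h' : ((N.factorial : ℝ) * (2 * Real.pi) ^ N) *
      ((lawSU N).real (cell N 2 (gramInterval N)) - (lawU N).real (cell N 2 (gramInterval N))) =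
      2 * ((2 * Real.pi) ^ (N - 2) * (N - 2).factorial * (8 *
        (1 / ((N : ℝ) ^ 2 - 1) * Real.sin (Real.pi / N) ^ 2 - sineSum N))) := by
    apply Complex.ofReal_injective
    push_cast at h ⊢
    linear_combination h
  have hf : ((N - 2).factorial : ℝ) ≠ 0 := by positivity
  have hp : (2 * Real.pi) ^ (N - 2) ≠ 0 := by positivity
  have hpi : Real.pi ≠ 0 := Real.pi_ne_zero
  rw [show (2 * Real.pi) ^ N = (2 * Real.pi) ^ (N - 2) * (2 * Real.pi) ^ 2 by
    rw [← pow_add, Nat.sub_add_cancel (by omega)]] at h'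
  set D := (lawSU N).real (cell N 2 (gramInterval N)) - (lawU N).real (cell N 2 (gramInterval N))
  set E := 1 / ((N : ℝ) ^ 2 - 1) * Real.sin (Real.pi / N) ^ 2 - sineSum N
  have h2 : (N.factorial : ℝ) * D * Real.pi ^ 2 = (N - 2).factorial * (4 * E) := by
    have := mul_left_cancel₀ hp (b := (N.factorial : ℝ) * D * Real.pi ^ 2 * 4)
      (c := (N - 2).factorial * (4 * E) * 4) (by linear_combination h')
    linarith
  field_simp
  linear_combination h2

theorem double_sum_eq_sineSum {N : ℕ} (hN : 1 ≤ N) :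
    (∑ k₁ ∈ Finset.Icc 1 (N - 1), ∑ k₂ ∈ Finset.Icc 1 (N - 1),
      if k₁ + k₂ = N then
        1 / ((k₁ : ℝ) * (k₂ : ℝ)) * Real.sin (k₁ * Real.pi / N) * Real.sin (k₂ * Real.pi / N)
      else 0) = sineSum N := by
  rw [sineSum, Fin.sum_univ_eq_sum_range (fun k : ℕ => 1 / (((k + 1 : ℕ) : ℝ) *
    ((N - (k + 1) : ℕ) : ℝ)) * Real.sin ((k + 1 : ℕ) * Real.pi / N) *
      Real.sin ((N - (k + 1) : ℕ) * Real.pi / N)) (N - 1),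
    show Finset.Icc 1 (N - 1) = Finset.Ico 1 N by ext; simp; omega]
  rw [Finset.sum_Ico_eq_sum_range]
  refine Finset.sum_congr rfl fun k hk => ?_
  have hk := Finset.mem_range.1 hk
  rw [add_comm 1 k, Finset.sum_eq_single (N - (k + 1))]
  · rw [if_pos (by omega)]
  · intro b _ hb
    rw [if_neg (by omega)]
  · intro h
    exact absurd (Finset.mem_Ico.2 ⟨by omega, by omega⟩) h

/-! ### The cosine integral and Euler's constant. -/

open scoped Topology

/-- The entire function `(1 - e^{-z}) / z`. -/
noncomputable def expQuot : ℂ → ℂ := dslope (fun z => -Complex.exp (-z)) 0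

theorem expQuot_of_ne {z : ℂ} (hz : z ≠ 0) : expQuot z = (1 - Complex.exp (-z)) / z := by
  rw [expQuot, dslope_of_ne _ hz, slope_def_field]
  simp; ring

theorem expQuot_zero : expQuot 0 = 1 := by
  have h : HasDerivAt (fun z : ℂ => -Complex.exp (-z)) 1 0 := by
    exact ((hasDerivAt_neg (0 : ℂ)).cexp).neg.congr_deriv (by simp)
  rw [expQuot, dslope_same, h.deriv]

theorem mul_expQuot (z : ℂ) : z * expQuot z = 1 - Complex.exp (-z) := by
  by_cases hz : z = 0
  · simp [hz]
  · rw [expQuot_of_ne hz]; field_simp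

theorem differentiable_expQuot : Differentiable ℂ expQuot := by
  rw [← differentiableOn_univ, expQuot, Complex.differentiableOn_dslope univ_mem]
  fun_prop

/-- The kernel `(1 - cos t) / t` of the entire cosine integral. -/
noncomputable def cinKernel (t : ℝ) : ℝ := (1 - Real.cos t) / t

theorem cinKernel_eq (t : ℝ) : cinKernel t = (Complex.I * expQuot (t * Complex.I)).re := by
  by_cases ht : t = 0
  · simp [ht, cinKernel, expQuot_zero]
  · have h : Complex.I * expQuot (t * Complex.I) = (1 - Complex.exp (-(t * Complex.I))) / t := by
      have : (t : ℂ) ≠ 0 := by exact_mod_cast ht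
      rw [expQuot_of_ne (mul_ne_zero this Complex.I_ne_zero)]
      field_simp
    rw [h, Complex.div_ofReal_re, cinKernel, ← neg_mul, ← Complex.ofReal_neg,
      Complex.sub_re, Complex.exp_ofReal_mul_I_re, Real.cos_neg, Complex.one_re]

/-- The kernel comes from an entire function; the default value 0/0 = 0 at the origin is its true
limit. Two derivatives are what the trapezoidal estimate needs. -/
theorem contDiff_cinKernel : ContDiff ℝ 2 cinKernel := by
  have h : ContDiff ℝ 2 expQuot := (differentiable_expQuot.contDiff (n := 2)).restrict_scalars ℝ
  have : cinKernel = fun t : ℝ => Complex.reCLM (Complex.I * expQuot (Complex.ofRealCLM t * Complex.I)) :=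
    funext cinKernel_eq
  rw [this]
  fun_prop

/-- The entire cosine integral `∫_0^T (1 - cos t) / t dt`. -/
noncomputable def cin (T : ℝ) : ℝ := ∫ t in (0 : ℝ)..T, cinKernel t

/-- The entire exponential integral `∫_0^T (1 - e^{-t}) / t dt`. -/
noncomputable def ein (T : ℝ) : ℝ := ∫ t in (0 : ℝ)..T, (expQuot t).re

theorem re_expQuot_ofReal {t : ℝ} (ht : t ≠ 0) : (expQuot t).re = (1 - Real.exp (-t)) / t := by
  rw [expQuot_of_ne (by exact_mod_cast ht), ← Complex.ofReal_neg, ← Complex.ofReal_exp,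
    ← Complex.ofReal_one, ← Complex.ofReal_sub, ← Complex.ofReal_div, Complex.ofReal_re]

/-- A primitive of the entire function `expQuot` compares the segments [0, T] and [0, iT] through
the quarter circle from T to iT. There z `expQuot z` = 1 − e^{−z}, and the 1 contributes a purely
imaginary amount. -/
theorem cin_sub_ein {T : ℝ} (hT : 0 < T) : cin T - ein T =
    -∫ φ in (0 : ℝ)..Real.pi / 2,
      (Complex.I * Complex.exp (-(T * Complex.exp (φ * Complex.I)))).re := by
  obtain ⟨P, hP⟩ := (differentiable_expQuot.differentiableOn (s := Metric.ball 0 (T + 1))).isExactOn_ball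
  have hc := differentiable_expQuot.continuous
  have h1 : ∫ t in (0 : ℝ)..T, expQuot t = P T - P 0 := by
    refine (intervalIntegral.integral_eq_sub_of_hasDerivAt (f := fun t : ℝ => P t)
      (fun t ht => ?_) ?_).trans (by simp)
    · rw [Set.uIcc_of_le hT.le] at ht
      refine (hP t ?_).comp_ofReal
      rw [mem_ball_zero_iff, Complex.norm_real, Real.norm_of_nonneg ht.1]
      linarith [ht.2]
    · exact (hc.comp Complex.continuous_ofReal).intervalIntegrable _ _
  have h2 : ∫ t in (0 : ℝ)..T, Complex.I * expQuot (t * Complex.I) = P (T * Complex.I) - P 0 := by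
    refine (intervalIntegral.integral_eq_sub_of_hasDerivAt
      (f := fun t : ℝ => P (t * Complex.I)) (fun t ht => ?_) ?_).trans (by simp)
    · rw [Set.uIcc_of_le hT.le] at ht
      have := (hP (t * Complex.I) (by
        rw [mem_ball_zero_iff, norm_mul, Complex.norm_I, Complex.norm_real,
          Real.norm_of_nonneg ht.1]
        linarith [ht.2])).comp t
        (((hasDerivAt_id t).ofReal_comp).mul_const Complex.I)
      exact this.congr_deriv (by simp [mul_comm])
    · exact Continuous.intervalIntegrable (by fun_prop) _ _
  have h3 : ∫ φ in (0 : ℝ)..Real.pi / 2,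
      Complex.I * (1 - Complex.exp (-(T * Complex.exp (φ * Complex.I)))) =
      P (T * Complex.I) - P T := by
    refine (intervalIntegral.integral_eq_sub_of_hasDerivAt
      (f := fun φ : ℝ => P (T * Complex.exp (φ * Complex.I))) (fun φ _ => ?_) ?_).trans ?_
    · have := (hP (T * Complex.exp (φ * Complex.I)) (by
        rw [mem_ball_zero_iff, norm_mul, Complex.norm_exp_ofReal_mul_I, Complex.norm_real,
          Real.norm_of_nonneg hT.le]
        linarith)).comp φ
        (((((hasDerivAt_id φ).ofReal_comp).mul_const Complex.I).cexp).const_mul (T : ℂ))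
      refine this.congr_deriv ?_
      rw [← mul_expQuot]
      simp; ring
    · exact Continuous.intervalIntegrable (by fun_prop) _ _
    · congr 2
      · push_cast; rw [Complex.exp_pi_div_two_mul_I]
      · simp
  have hre : ∀ {a b : ℝ} {f : ℝ → ℂ}, Continuous f →
      (∫ t in a..b, f t).re = ∫ t in a..b, (f t).re := fun {a b f} hf =>
    (Complex.reCLM.intervalIntegral_comp_comm (hf.intervalIntegrable a b)).symm
  have e1 : ein T = (P T - P 0).re := by
    rw [← h1, hre (by fun_prop), ein]
  have e2 : cin T = (P (T * Complex.I) - P 0).re := by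
    rw [← h2, hre (by fun_prop), cin]
    simp only [cinKernel_eq]
  have e3 := congrArg Complex.re h3
  rw [hre (by fun_prop)] at e3
  rw [e1, e2, ← Complex.sub_re, sub_sub_sub_cancel_right, ← e3, ← intervalIntegral.integral_neg]
  congr 1
  ext φ
  simp [mul_sub]

/-- Dominated convergence on the arc: the integrand is at most exp(−T cos φ), which tends to 0
except at φ = π/2. -/
theorem tendsto_cin_sub_ein : Tendsto (fun T => cin T - ein T) atTop (𝓝 0) := by
  have key : Tendsto (fun T : ℝ => ∫ φ in (0 : ℝ)..Real.pi / 2,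
      (Complex.I * Complex.exp (-(T * Complex.exp (φ * Complex.I)))).re) atTop
      (𝓝 (∫ φ in (0 : ℝ)..Real.pi / 2, (0 : ℝ))) := by
    have hle : ∀ T φ : ℝ, ‖(Complex.I * Complex.exp (-(T * Complex.exp (φ * Complex.I)))).re‖ ≤
        Real.exp (-(T * Real.cos φ)) := fun T φ => by
      refine (Complex.abs_re_le_norm _).trans ?_
      rw [norm_mul, Complex.norm_I, one_mul, Complex.norm_exp]
      simp [Complex.exp_ofReal_mul_I_re]
    refine intervalIntegral.tendsto_integral_filter_of_dominated_convergence (fun _ => 1)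
      (.of_forall fun T => Continuous.aestronglyMeasurable (by fun_prop)) ?_
      intervalIntegrable_const ?_
    · filter_upwards [eventually_ge_atTop 0] with T hT
      refine .of_forall fun φ hφ => (hle T φ).trans ?_
      rw [Set.uIoc_of_le (by positivity)] at hφ
      rw [Real.exp_le_one_iff, neg_nonpos]
      exact mul_nonneg hT (Real.cos_nonneg_of_mem_Icc ⟨by linarith [hφ.1, Real.pi_pos], hφ.2⟩)
    · have hne : ∀ᵐ φ : ℝ, φ ≠ Real.pi / 2 := by
        simp [ae_iff, measure_singleton]
      filter_upwards [hne] with φ hφ hmem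
      rw [Set.uIoc_of_le (by positivity)] at hmem
      have hcos : 0 < Real.cos φ := Real.cos_pos_of_mem_Ioo
        ⟨by linarith [hmem.1, Real.pi_pos], lt_of_le_of_ne hmem.2 hφ⟩
      refine squeeze_zero_norm (fun T => hle T φ) ?_
      exact Real.tendsto_exp_neg_atTop_nhds_zero.comp (tendsto_id.atTop_mul_const hcos)
  rw [intervalIntegral.integral_zero] at key
  have := key.neg
  rw [neg_zero] at this
  refine this.congr' ?_
  filter_upwards [eventually_gt_atTop 0] with T hT using (cin_sub_ein hT).symm

/-- Differentiating Euler's integral under the integral sign, both sides are Γ'(1). -/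
theorem integral_log_mul_exp_neg :
    ∫ t in Set.Ioi (0 : ℝ), Real.log t * Real.exp (-t) = -Real.eulerMascheroniConstant := by
  have h1 := Complex.hasDerivAt_GammaIntegral (s := 1) (by simp)
  have h2 : Complex.Gamma =ᶠ[𝓝 1] Complex.GammaIntegral := by
    have : ∀ᶠ s : ℂ in 𝓝 1, 0 < s.re :=
      (Complex.continuous_re.tendsto 1).eventually (lt_mem_nhds (by simp))
    filter_upwards [this] with s hs using Complex.Gamma_eq_integral hs
  have h3 := (h1.congr_of_eventuallyEq h2).unique Complex.hasDerivAt_Gamma_one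
  rw [← Complex.ofReal_inj, ← integral_complex_ofReal, Complex.ofReal_neg, ← h3]
  refine setIntegral_congr_fun measurableSet_Ioi fun t ht => ?_
  simp

theorem integrableOn_log_mul_exp_neg :
    IntegrableOn (fun t : ℝ => Real.log t * Real.exp (-t)) (Set.Ioi 0) := by
  by_contra h
  have h1 := integral_log_mul_exp_neg
  -- A non-integrable function has integral 0 by convention, but the integral is −γ ≠ 0.
  rw [integral_undef h] at h1
  linarith [Real.one_half_lt_eulerMascheroniConstant]

/-- Integration by parts; (1 − e^{−t}) log t is continuous at 0 because t log t is. -/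
theorem ein_eq {T : ℝ} (hT : 0 < T) : ein T =
    (1 - Real.exp (-T)) * Real.log T - ∫ t in (0 : ℝ)..T, Real.log t * Real.exp (-t) := by
  have hc : Continuous fun t : ℝ => (expQuot t).re :=
    Complex.continuous_re.comp (differentiable_expQuot.continuous.comp Complex.continuous_ofReal)
  have hint : IntervalIntegrable (fun t : ℝ => Real.log t * Real.exp (-t)) volume 0 T :=
    (intervalIntegrable_iff_integrableOn_Ioc_of_le hT.le).2
      (integrableOn_log_mul_exp_neg.mono_set Set.Ioc_subset_Ioi_self)
  have hint' : IntervalIntegrable (fun t : ℝ => (expQuot t).re) volume 0 T :=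
    hc.intervalIntegrable _ _
  rw [eq_sub_iff_add_eq, ein, ← intervalIntegral.integral_add hint' hint]
  have hcont : Continuous fun t : ℝ => (1 - Real.exp (-t)) * Real.log t := by
    have : (fun t : ℝ => (1 - Real.exp (-t)) * Real.log t) =
        fun t : ℝ => (expQuot t).re * (t * Real.log t) := by
      funext t
      by_cases ht : t = 0
      · simp [ht]
      · rw [re_expQuot_ofReal ht]; field_simp
    rw [this]
    exact hc.mul Real.continuous_mul_log
  have := intervalIntegral.integral_eq_sub_of_hasDerivAt_of_le hT.le
    (f := fun t : ℝ => (1 - Real.exp (-t)) * Real.log t) hcont.continuousOn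
    (f' := fun t => (expQuot t).re + Real.log t * Real.exp (-t)) (fun t ht => ?_)
    (hint'.add hint)
  · simpa using this
  · have h := (((hasDerivAt_neg t).exp).const_sub 1).mul (Real.hasDerivAt_log ht.1.ne')
    refine h.congr_deriv ?_
    rw [re_expQuot_ofReal ht.1.ne']
    simp; ring

theorem tendsto_ein_sub_log :
    Tendsto (fun T => ein T - Real.log T) atTop (𝓝 Real.eulerMascheroniConstant) := by
  have h1 := intervalIntegral_tendsto_integral_Ioi 0 integrableOn_log_mul_exp_neg tendsto_id
  rw [integral_log_mul_exp_neg] at h1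
  have h2 : Tendsto (fun T : ℝ => Real.exp (-T) * Real.log T) atTop (𝓝 0) := by
    have h := Real.tendsto_pow_mul_exp_neg_atTop_nhds_zero 1
    refine squeeze_zero' ?_ ?_ h
    · filter_upwards [eventually_ge_atTop 1] with T hT
      exact mul_nonneg (Real.exp_pos _).le (Real.log_nonneg hT)
    · filter_upwards [eventually_gt_atTop 0] with T hT
      rw [pow_one, mul_comm]
      exact mul_le_mul_of_nonneg_right ((Real.log_le_sub_one_of_pos hT).trans (by linarith))
        (Real.exp_pos _).le
  have h3 := (h2.neg).sub h1
  rw [neg_zero, zero_sub, neg_neg] at h3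
  refine h3.congr' ?_
  filter_upwards [eventually_gt_atTop 0] with T hT
  rw [ein_eq hT]
  simp only [id]
  ring

theorem tendsto_cin_sub_log :
    Tendsto (fun T => cin T - Real.log T) atTop (𝓝 Real.eulerMascheroniConstant) := by
  have := tendsto_cin_sub_ein.add tendsto_ein_sub_log
  rw [zero_add] at this
  exact this.congr fun T => by ring

/-- Write cos t / t as 1/t minus the kernel and use cin T − log T → γ. -/
theorem cosIntegral_eq {x : ℝ} (hx : 0 < x) :
    cosIntegral x = Real.eulerMascheroniConstant + Real.log x - cin x := by
  have hlim : Tendsto (fun T : ℝ => ∫ t in x..T, Real.cos t / t) atTop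
      (𝓝 (-Real.eulerMascheroniConstant - Real.log x + cin x)) := by
    have h := (tendsto_cin_sub_log.neg.sub_const (Real.log x)).add_const (cin x)
    refine h.congr' ?_
    filter_upwards [eventually_ge_atTop x] with T hT
    have hk : ∀ a b : ℝ, IntervalIntegrable cinKernel volume a b := fun a b =>
      contDiff_cinKernel.continuous.intervalIntegrable a b
    have h0 : (0 : ℝ) ∉ Set.uIcc x T := by
      rw [Set.uIcc_of_le hT]
      exact fun h => absurd h.1 (not_le.2 hx)
    have hinv : IntervalIntegrable (fun t : ℝ => t⁻¹) volume x T :=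
      intervalIntegral.intervalIntegrable_inv (fun t ht h => h0 (h ▸ ht)) continuousOn_id
    have e : ∫ t in x..T, Real.cos t / t = ∫ t in x..T, (t⁻¹ - cinKernel t) := by
      refine intervalIntegral.integral_congr fun t _ => ?_
      simp only [cinKernel]
      rw [div_eq_mul_inv, div_eq_mul_inv]; ring
    have e2 : ∫ t in x..T, cinKernel t = cin T - cin x :=
      (intervalIntegral.integral_interval_sub_left (hk _ _) (hk _ _)).symm
    rw [e, intervalIntegral.integral_sub hinv (hk _ _), integral_inv h0, e2,
      Real.log_div (hx.trans_le hT).ne' hx.ne']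
    ring
  rw [cosIntegral, hlim.limUnder_eq]
  ring

theorem alpha_eq : alpha = 4 * cin (2 * Real.pi) / Real.pi ^ 2 := by
  rw [alpha, cosIntegral_eq Real.two_pi_pos]
  congr 1
  ring

/-! ### Asymptotics by the trapezoidal rule. -/

theorem exists_bound_iteratedDerivWithin_two {f : ℝ → ℝ} (hf : ContDiff ℝ 2 f) :
    ∃ ζ, ∀ x, |iteratedDerivWithin 2 f (Set.uIcc 0 1) x| ≤ ζ := by
  have huniq : UniqueDiffOn ℝ (Set.uIcc (0 : ℝ) 1) := by
    rw [Set.uIcc_of_le zero_le_one]; exact uniqueDiffOn_Icc zero_lt_one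
  have hcont := hf.contDiffOn (s := Set.uIcc (0 : ℝ) 1) |>.continuousOn_iteratedDerivWithin
    (m := 2) le_rfl huniq
  obtain ⟨ζ, hζ⟩ := isCompact_uIcc.exists_bound_of_continuousOn hcont
  refine ⟨max ζ 0, fun x => ?_⟩
  by_cases hx : x ∈ Set.uIcc (0 : ℝ) 1
  · exact (hζ x hx).trans (le_max_left _ _)
  -- The trapezoidal estimate wants the bound at every real x; off the closed interval the
  -- derivative within it is 0 by default.
  · rw [iteratedDerivWithin_succ, derivWithin_zero_of_notMem_closure, abs_zero]
    · exact le_max_right _ _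
    · rwa [isCompact_uIcc.isClosed.closure_eq]

theorem integral_cinKernel_scaled :
    ∫ x in (0 : ℝ)..1, 2 * Real.pi * cinKernel (2 * Real.pi * x) = cin (2 * Real.pi) := by
  rw [intervalIntegral.integral_const_mul, intervalIntegral.mul_integral_comp_mul_left, cin]
  simp

/-- With k₁ + k₂ = N the sines agree and N/(k₁k₂) = 1/k₁ + 1/k₂. The reflection k ↦ N − k merges
both halves, leaving ∑ (1 − cos(2πk/N))/k, whose endpoint terms in the trapezoidal rule vanish. -/
theorem sineSum_eq {N : ℕ} (hN : 1 ≤ N) : N * sineSum N =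
    trapezoidal_integral (fun x => 2 * Real.pi * cinKernel (2 * Real.pi * x)) N 0 1 := by
  have hN0 : (N : ℝ) ≠ 0 := by exact_mod_cast (by omega : N ≠ 0)
  have hpi := Real.pi_ne_zero
  have h0 : ∀ k : ℕ, 2 * Real.pi * cinKernel (2 * Real.pi * (0 + ((k : ℝ) + 1) * (1 - 0) / N)) =
      N * ((1 - Real.cos (2 * (((k + 1 : ℕ) : ℝ) * Real.pi / N))) / (k + 1 : ℕ)) := fun k => by
    have : ((k + 1 : ℕ) : ℝ) ≠ 0 := by positivity
    have e : 2 * Real.pi * (0 + ((k : ℝ) + 1) * (1 - 0) / N) =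
        2 * (((k + 1 : ℕ) : ℝ) * Real.pi / N) := by push_cast; ring
    rw [e, cinKernel]
    field_simp
  rw [trapezoidal_integral]
  simp only [h0]
  have hz : cinKernel (2 * Real.pi * 0) = 0 := by simp [cinKernel]
  have ho : cinKernel (2 * Real.pi * 1) = 0 := by simp [cinKernel]
  rw [hz, ho, mul_zero, add_zero, zero_div, zero_add, ← Finset.mul_sum, sub_zero, ← mul_assoc,
    one_div_mul_cancel hN0, one_mul]
  have hsin : ∀ k ∈ Finset.range (N - 1), Real.sin ((N - (k + 1) : ℕ) * Real.pi / N) =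
      Real.sin ((k + 1 : ℕ) * Real.pi / N) := fun k hk => by
    have hk := Finset.mem_range.1 hk
    rw [← Real.sin_pi_sub]
    congr 1
    rw [Nat.cast_sub (by omega)]
    field_simp
    ring
  set a : ℕ → ℝ := fun k => Real.sin ((k + 1 : ℕ) * Real.pi / N) ^ 2 with ha
  have hcos : ∀ k : ℕ, 1 - Real.cos (2 * (((k + 1 : ℕ) : ℝ) * Real.pi / N)) = 2 * a k := fun k => by
    rw [Real.cos_two_mul, ha]
    linarith [Real.sin_sq_add_cos_sq (((k + 1 : ℕ) : ℝ) * Real.pi / N)]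
  simp only [hcos]
  rw [sineSum, Fin.sum_univ_eq_sum_range (fun k : ℕ => 1 / (((k + 1 : ℕ) : ℝ) *
    ((N - (k + 1) : ℕ) : ℝ)) * Real.sin ((k + 1 : ℕ) * Real.pi / N) *
      Real.sin ((N - (k + 1) : ℕ) * Real.pi / N)) (N - 1), Finset.mul_sum]
  have h1 : ∀ k ∈ Finset.range (N - 1), (N : ℝ) * (1 / (((k + 1 : ℕ) : ℝ) *
      ((N - (k + 1) : ℕ) : ℝ)) * Real.sin ((k + 1 : ℕ) * Real.pi / N) *
      Real.sin ((N - (k + 1) : ℕ) * Real.pi / N)) =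
      a k / (k + 1 : ℕ) + a k / (N - (k + 1) : ℕ) := fun k hk => by
    rw [hsin k hk]
    have hk := Finset.mem_range.1 hk
    have e1 : ((k + 1 : ℕ) : ℝ) ≠ 0 := by positivity
    have e2 : ((N - (k + 1) : ℕ) : ℝ) ≠ 0 := by exact_mod_cast (by omega : N - (k + 1) ≠ 0)
    have e3 : (N : ℝ) = (k + 1 : ℕ) + (N - (k + 1) : ℕ) := by
      rw [Nat.cast_sub (by omega)]; ring
    rw [ha]
    field_simp
    linear_combination Real.sin ((k + 1 : ℕ) * Real.pi / N) ^ 2 * e3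
  have h2 : ∑ k ∈ Finset.range (N - 1), a k / (N - (k + 1) : ℕ) =
      ∑ k ∈ Finset.range (N - 1), a k / (k + 1 : ℕ) := by
    rw [← Finset.sum_range_reflect]
    refine Finset.sum_congr rfl fun k hk => ?_
    have hk' := Finset.mem_range.1 hk
    have e1 : N - 1 - 1 - k + 1 = N - (k + 1) := by omega
    have e2 : N - (N - (k + 1)) = k + 1 := by omega
    rw [ha]
    simp only
    rw [e1, e2, hsin k hk]
  rw [Finset.sum_congr rfl h1, Finset.sum_add_distrib, h2, ← two_mul, Finset.mul_sum]
  exact Finset.sum_congr rfl fun k _ => by ring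

theorem exists_sineSum_bound : ∃ C, ∀ N : ℕ, 1 ≤ N →
    |sineSum N - cin (2 * Real.pi) / N| ≤ C * (1 / (N : ℝ) ^ 3) := by
  have hf : ContDiff ℝ 2 fun x => 2 * Real.pi * cinKernel (2 * Real.pi * x) := by
    have := contDiff_cinKernel
    fun_prop
  obtain ⟨ζ, hζ⟩ := exists_bound_iteratedDerivWithin_two hf
  refine ⟨ζ / 12, fun N hN => ?_⟩
  have hNpos : (0 : ℝ) < N := by exact_mod_cast hN
  have h := trapezoidal_error_le_of_c2 hf.contDiffOn hζ (by omega : 0 < N)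
  rw [trapezoidal_error, ← sineSum_eq hN, integral_cinKernel_scaled] at h
  have e : sineSum N - cin (2 * Real.pi) / N = (N * sineSum N - cin (2 * Real.pi)) / N := by
    field_simp
  rw [e, abs_div, abs_of_pos hNpos, div_le_iff₀ hNpos]
  refine h.trans (le_of_eq ?_)
  norm_num
  field_simp

theorem integralX_two_isBigO :
    (fun N : ℕ => integralX N 2 (gramInterval N) - (-(alpha / N)))
      =O[atTop] fun N : ℕ => 1 / (N : ℝ) ^ 3 := by
  obtain ⟨C, hC⟩ := exists_sineSum_bound
  refine IsBigO.of_bound (4 / Real.pi ^ 2 * (Real.pi ^ 2 + C)) ?_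
  filter_upwards [eventually_ge_atTop 3] with N hN
  have hN' : (3 : ℝ) ≤ N := by exact_mod_cast hN
  have hpi := Real.pi_pos
  have e : integralX N 2 (gramInterval N) - (-(alpha / N)) = 4 / Real.pi ^ 2 *
      (1 / ((N : ℝ) ^ 2 - 1) * Real.sin (Real.pi / N) ^ 2 -
        (sineSum N - cin (2 * Real.pi) / N)) := by
    rw [integralX_two hN, alpha_eq]
    ring
  have h1 : |1 / ((N : ℝ) ^ 2 - 1) * Real.sin (Real.pi / N) ^ 2| ≤
      Real.pi ^ 2 * (1 / (N : ℝ) ^ 3) := by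
    have hsin : Real.sin (Real.pi / N) ^ 2 ≤ (Real.pi / N) ^ 2 := by
      rw [← sq_abs (Real.sin _), ← sq_abs (Real.pi / N)]
      exact pow_le_pow_left₀ (abs_nonneg _) Real.abs_sin_le_abs 2
    -- The term is really of order N⁻⁴; this crude bound already gives N⁻³.
    have hd : (N : ℝ) ≤ (N : ℝ) ^ 2 - 1 := by nlinarith
    have hd' : 1 / ((N : ℝ) ^ 2 - 1) ≤ 1 / N := one_div_le_one_div_of_le (by linarith) hd
    have hd0 : 0 ≤ 1 / ((N : ℝ) ^ 2 - 1) := one_div_nonneg.2 (by linarith)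
    rw [abs_of_nonneg (mul_nonneg hd0 (sq_nonneg _))]
    calc _ ≤ 1 / N * (Real.pi / N) ^ 2 :=
          mul_le_mul hd' hsin (sq_nonneg _) (by positivity)
      _ = _ := by field_simp
  have h2 := hC N (by omega)
  rw [e, norm_mul, Real.norm_of_nonneg (by positivity : 0 ≤ 4 / Real.pi ^ 2),
    Real.norm_of_nonneg (by positivity : 0 ≤ 1 / (N : ℝ) ^ 3), mul_assoc, Real.norm_eq_abs]
  refine mul_le_mul_of_nonneg_left ?_ (by positivity)
  calc _ ≤ _ := abs_sub _ _
    _ ≤ Real.pi ^ 2 * (1 / (N : ℝ) ^ 3) + C * (1 / (N : ℝ) ^ 3) := add_le_add h1 h2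
    _ = _ := by ring

/-! ### The numerical value of α. -/

theorem re_exp_partial_sum (t : ℝ) (n : ℕ) :
    (∑ m ∈ Finset.range (2 * n), (t * Complex.I) ^ m / (m.factorial : ℂ)).re =
      ∑ k ∈ Finset.range n, (-1) ^ k * t ^ (2 * k) / ((2 * k).factorial : ℝ) := by
  induction n with
  | zero => simp
  | succ n ih =>
    rw [show 2 * (n + 1) = 2 * n + 1 + 1 by ring, Finset.sum_range_succ, Finset.sum_range_succ,
      Finset.sum_range_succ _ n, Complex.add_re, Complex.add_re, ih]
    have h1 : ((t * Complex.I) ^ (2 * n) / ((2 * n).factorial : ℂ)) =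
        (((-1) ^ n * t ^ (2 * n) / ((2 * n).factorial : ℝ) : ℝ) : ℂ) := by
      rw [mul_pow, pow_mul Complex.I, Complex.I_sq]; push_cast; ring
    have h2 : ((t * Complex.I) ^ (2 * n + 1) / ((2 * n + 1).factorial : ℂ)) =
        (((-1) ^ n * t ^ (2 * n + 1) / ((2 * n + 1).factorial : ℝ) : ℝ) : ℂ) * Complex.I := by
      rw [mul_pow, pow_succ Complex.I, pow_mul Complex.I, Complex.I_sq]; push_cast; ring
    rw [h1, h2, Complex.ofReal_re, Complex.re_ofReal_mul, Complex.I_re, mul_zero, add_zero]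

theorem abs_cos_sub_le {t : ℝ} {n : ℕ} (ht : |t| / ((2 * n).succ : ℕ) ≤ 1 / 2) :
    |Real.cos t - ∑ k ∈ Finset.range n, (-1) ^ k * t ^ (2 * k) / ((2 * k).factorial : ℝ)| ≤
      |t| ^ (2 * n) / ((2 * n).factorial : ℝ) * 2 := by
  have hn : ‖(t * Complex.I : ℂ)‖ = |t| := by simp
  have h := Complex.exp_bound' (x := t * Complex.I) (n := 2 * n) (by rw [hn]; exact ht)
  rw [hn] at h
  refine le_trans ?_ h
  have := Complex.abs_re_le_norm
    (Complex.exp (t * Complex.I) - ∑ m ∈ Finset.range (2 * n), (t * Complex.I) ^ m / m.factorial)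
  rwa [Complex.sub_re, re_exp_partial_sum, Complex.exp_ofReal_mul_I_re] at this

/-- Divide the Taylor bound for cos with n + 1 terms by t and integrate; its constant term cancels
the 1 in the kernel, leaving n terms. -/
theorem abs_cin_sub_le {T : ℝ} (hT : 0 ≤ T) {n : ℕ} (hn : T / ((2 * (n + 1)).succ : ℕ) ≤ 1 / 2) :
    |cin T - ∑ k ∈ Finset.range n, (-1) ^ k * T ^ (2 * (k + 1)) /
        ((2 * (k + 1)) * ((2 * (k + 1)).factorial : ℝ))| ≤
      2 * T ^ (2 * (n + 1)) / ((2 * (n + 1)) * ((2 * (n + 1)).factorial : ℝ)) := by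
  have hpoly : ∑ k ∈ Finset.range n, (-1) ^ k * T ^ (2 * (k + 1)) /
        ((2 * (k + 1)) * ((2 * (k + 1)).factorial : ℝ)) =
      ∫ t in (0 : ℝ)..T, ∑ k ∈ Finset.range n,
        (-1) ^ k / ((2 * (k + 1)).factorial : ℝ) * t ^ (2 * k + 1) := by
    rw [intervalIntegral.integral_finsetSum]
    · refine Finset.sum_congr rfl fun k _ => ?_
      rw [intervalIntegral.integral_const_mul, integral_pow]
      have : ((2 * (k + 1)).factorial : ℝ) ≠ 0 := by positivity
      push_cast
      rw [zero_pow (by omega)]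
      field_simp
      ring
    · intro k _
      exact Continuous.intervalIntegrable (by fun_prop) _ _
  have hrem : 2 * T ^ (2 * (n + 1)) / ((2 * (n + 1)) * ((2 * (n + 1)).factorial : ℝ)) =
      ∫ t in (0 : ℝ)..T, 2 / ((2 * (n + 1)).factorial : ℝ) * t ^ (2 * n + 1) := by
    rw [intervalIntegral.integral_const_mul, integral_pow]
    have : ((2 * (n + 1)).factorial : ℝ) ≠ 0 := by positivity
    push_cast
    rw [zero_pow (by omega)]
    field_simp
    ring
  rw [hpoly, hrem, cin, ← intervalIntegral.integral_sub
    (contDiff_cinKernel.continuous.intervalIntegrable _ _)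
    (Continuous.intervalIntegrable (by fun_prop) _ _), ← Real.norm_eq_abs]
  refine intervalIntegral.norm_integral_le_of_norm_le hT (.of_forall fun t ht => ?_)
    (Continuous.intervalIntegrable (by fun_prop) _ _)
  have ht0 : 0 < t := ht.1
  have h := abs_cos_sub_le (t := t) (n := n + 1) (by
    rw [abs_of_pos ht0]
    exact (div_le_div_of_nonneg_right ht.2 (by positivity)).trans hn)
  rw [abs_of_pos ht0, Finset.sum_range_succ'] at h
  have e : cinKernel t - ∑ k ∈ Finset.range n,
      (-1) ^ k / ((2 * (k + 1)).factorial : ℝ) * t ^ (2 * k + 1) =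
      -((Real.cos t - (∑ k ∈ Finset.range n, (-1) ^ (k + 1) * t ^ (2 * (k + 1)) /
        ((2 * (k + 1)).factorial : ℝ) + (-1) ^ 0 * t ^ (2 * 0) / ((2 * 0).factorial : ℝ))) / t) := by
    have : ∑ k ∈ Finset.range n, (-1) ^ (k + 1) * t ^ (2 * (k + 1)) /
        ((2 * (k + 1)).factorial : ℝ) = -(t * ∑ k ∈ Finset.range n,
      (-1) ^ k / ((2 * (k + 1)).factorial : ℝ) * t ^ (2 * k + 1)) := by
      rw [Finset.mul_sum, ← Finset.sum_neg_distrib]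
      exact Finset.sum_congr rfl fun k _ => by ring
    rw [this, cinKernel]
    simp only [mul_zero, pow_zero, Nat.factorial_zero, Nat.cast_one]
    field_simp
    ring
  rw [e, norm_neg, norm_div, Real.norm_eq_abs, Real.norm_of_nonneg ht0.le, div_le_iff₀ ht0]
  refine h.trans (le_of_eq ?_)
  ring

theorem abs_alpha_sub_lt : |alpha - 0.987944| < 0.0000005 := by
  have hlo := Real.pi_gt_d20
  have hhi := Real.pi_lt_d20
  have hpi := Real.pi_pos
  -- Thirteen terms leave an error in α of about 2 · 10⁻⁹.
  have h := abs_cin_sub_le Real.two_pi_pos.le (n := 13) (by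
    rw [div_le_iff₀ (by positivity)]; norm_num; linarith)
  set y : ℝ := (2 * Real.pi) ^ 2 with hy
  have hy1 : (39.478417604 : ℝ) < y := by rw [hy]; nlinarith
  have hy2 : y < 39.478417605 := by rw [hy]; nlinarith
  have hy0 : 0 < y := by linarith
  have hα : alpha = 16 * cin (2 * Real.pi) / y := by
    rw [alpha_eq, hy]; field_simp; ring
  have hpow : ∀ k : ℕ, (2 * Real.pi) ^ (2 * (k + 1)) = y * y ^ k := fun k => by
    rw [pow_mul, ← hy, pow_succ']
  have hp : ∀ k : ℕ, (39.478417604 : ℝ) ^ k ≤ y ^ k ∧ y ^ k ≤ 39.478417605 ^ k := fun k =>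
    ⟨pow_le_pow_left₀ (by norm_num) hy1.le k, pow_le_pow_left₀ hy0.le hy2.le k⟩
  set s := ∑ k ∈ Finset.range 13, (-1) ^ k * y ^ k / ((2 * (k + 1)) * ((2 * (k + 1)).factorial : ℝ))
    with hs
  have hsum : ∑ k ∈ Finset.range 13, (-1) ^ k * (2 * Real.pi) ^ (2 * (k + 1)) /
      ((2 * (k + 1)) * ((2 * (k + 1)).factorial : ℝ)) = y * s := by
    rw [hs, Finset.mul_sum]
    exact Finset.sum_congr rfl fun k _ => by rw [hpow]; ring
  rw [hsum] at h
  have herr : |alpha - 16 * s| ≤ 16 * (2 * y ^ 13 / ((2 * (13 + 1)) * ((2 * (13 + 1)).factorial : ℝ))) := by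
    have e : alpha - 16 * s = 16 * ((cin (2 * Real.pi) - y * s) / y) := by
      rw [hα]; field_simp
    rw [e, abs_mul, abs_of_pos (by norm_num : (0 : ℝ) < 16), abs_div, abs_of_pos hy0]
    refine mul_le_mul_of_nonneg_left ?_ (by norm_num)
    rw [div_le_iff₀ hy0]
    refine h.trans (le_of_eq ?_)
    rw [hpow 13]
    push_cast
    ring
  have h13 := (hp 13).2
  simp only [Finset.sum_range_succ, Finset.sum_range_zero, Nat.factorial] at hs herr
  have b2 := hp 2
  have b3 := hp 3
  have b4 := hp 4
  have b5 := hp 5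
  have b6 := hp 6
  have b7 := hp 7
  have b8 := hp 8
  have b9 := hp 9
  have b10 := hp 10
  have b11 := hp 11
  have b12 := hp 12
  norm_num at hs herr b2 b3 b4 b5 b6 b7 b8 b9 b10 b11 b12 h13
  rw [abs_le] at herr
  rw [abs_lt]
  constructor
  · norm_num; linarith [herr.1, herr.2]
  · norm_num; linarith [herr.1, herr.2]

/-! ### Expansion of the probabilities. -/

instance {N : ℕ} : IsFiniteMeasure (lawU N) :=
  isFiniteMeasure_withDensity_ofReal
    (integrableOn_of_subset_box (continuous_densityU N) subset_rfl).2

instance {N : ℕ} : IsFiniteMeasure (lawSU N) := by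
  have : IsFiniteMeasure ((volume.restrict (box (N - 1))).withDensity fun θ =>
      ENNReal.ofReal (densitySU N θ)) :=
    isFiniteMeasure_withDensity_ofReal
      (integrableOn_of_subset_box (continuous_densitySU N) subset_rfl).2
  rw [lawSU_eq]
  infer_instance

theorem integralX_gram_one {N : ℕ} (hN : 1 ≤ N) : integralX N 1 (gramInterval N) = 0 := by
  rw [integralX_eq one_ne_zero hN (gramInterval_measurable N) (gramInterval_subset hN)]
  obtain rfl | h := hN.eq_or_lt
  -- For N = 1 no angle is left unconstrained, but the Gram interval is the full range and the claim
  -- is equality of total masses.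
  · have hJ : gramInterval 1 = Set.Ico (-Real.pi) Real.pi := by
      rw [gramInterval]; congr 1; push_cast; ring
    have hc : cell 1 1 (gramInterval 1) = cell 1 0 (gramInterval 1) := by
      rw [cell_self, cell_zero, hJ]; rfl
    rw [hc, law_difference_gram_eq_zero one_pos zero_le_one, sub_self, mul_zero]
  · rw [law_difference_gram_eq_zero h le_rfl, sub_self, mul_zero]

theorem probSU_sub_probU {N k : ℕ} (hN : 1 ≤ N) (hk : k ≤ N) :
    probSU N k (gramInterval N) - probU N k (gramInterval N) = ∑ n ∈ Finset.Icc k N,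
      (-1 : ℝ) ^ (n - k) / ((k.factorial : ℝ) * ((n - k).factorial : ℝ)) *
        integralX N n (gramInterval N) := by
  have hJm := gramInterval_measurable N
  have hJ := gramInterval_subset hN
  have hregion : MeasurableSet (region N k (gramInterval N)) :=
    MeasurableSet.univ_pi fun i => by split_ifs; exacts [hJm, measurableSet_Ico.diff hJm]
  have hsub : region N k (gramInterval N) ⊆ box N :=
    Set.pi_mono fun i _ => by split_ifs; exacts [hJ, Set.sdiff_subset]
  rw [probSU, probU, ← lawU_real hregion hsub,
    choose_mul_measureReal_region hk (measurePreserving_lawSU hN) hJm hJ,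
    choose_mul_measureReal_region hk measurePreserving_lawU hJm hJ, ← Finset.sum_sub_distrib]
  refine Finset.sum_congr rfl fun n hn => ?_
  rw [← mul_sub, ← mul_sub]
  congr 1
  by_cases h0 : n = 0
  · subst h0
    -- Equal total masses justify the convention X⁰ = 0.
    rw [integralX, if_pos rfl, law_difference_gram_eq_zero hN zero_le_one, sub_self, mul_zero]
  · rw [integralX_eq h0 (Finset.mem_Icc.1 hn).2 hJm hJ]

theorem probSU_expansion {N k : ℕ} (hN : 3 ≤ N) (hk : k ≤ 2) :
    probSU N k (gramInterval N) = probU N k (gramInterval N) +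
      (-1 : ℝ) ^ (2 - k) / ((k.factorial : ℝ) * ((2 - k).factorial : ℝ)) *
        integralX N 2 (gramInterval N) + higherTerms N k (gramInterval N) := by
  have h := probSU_sub_probU (by omega : 1 ≤ N) (by omega : k ≤ N)
  have hsplit : ∑ n ∈ Finset.Icc k N,
      (-1 : ℝ) ^ (n - k) / ((k.factorial : ℝ) * ((n - k).factorial : ℝ)) *
        integralX N n (gramInterval N) =
      (-1 : ℝ) ^ (2 - k) / ((k.factorial : ℝ) * ((2 - k).factorial : ℝ)) *
        integralX N 2 (gramInterval N) + higherTerms N k (gramInterval N) := by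
    rw [higherTerms]
    have hset : Finset.Icc k N = Finset.Icc k 2 ∪ Finset.Icc 3 N := by ext; simp; omega
    have hdisj : Disjoint (Finset.Icc k 2) (Finset.Icc 3 N) :=
      Finset.disjoint_left.2 fun a ha hb => by
        rw [Finset.mem_Icc] at ha hb; omega
    rw [hset, Finset.sum_union hdisj]
    congr 1
    refine Finset.sum_eq_single_of_mem 2 (Finset.mem_Icc.2 ⟨hk, le_rfl⟩) fun n hn hne => ?_
    have hn2 := (Finset.mem_Icc.1 hn).2
    obtain rfl | rfl : n = 0 ∨ n = 1 := by omega
    · rw [integralX, if_pos rfl, mul_zero]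
    · rw [integralX_gram_one (by omega), mul_zero]
  rw [hsplit] at h
  linarith

theorem probSU_expansion_isBigO {k : ℕ} (hk : k ≤ 2) :
    (fun N : ℕ => probSU N k (gramInterval N) - (probU N k (gramInterval N) +
      (-1 : ℝ) ^ (2 - k) / ((k.factorial : ℝ) * ((2 - k).factorial : ℝ)) * (-(alpha / N)) +
        higherTerms N k (gramInterval N))) =O[atTop] fun N : ℕ => 1 / (N : ℝ) ^ 3 := by
  refine (integralX_two_isBigO.const_mul_left
    ((-1 : ℝ) ^ (2 - k) / ((k.factorial : ℝ) * ((2 - k).factorial : ℝ)))).congr' ?_ .rfl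
  filter_upwards [eventually_ge_atTop 3] with N hN
  rw [probSU_expansion hN hk]
  ring

end GramLaw

theorem mainTheorem4 :
    -- the integral of `X¹` over a Gram interval vanishes
    (∀ N : ℕ, 1 ≤ N → GramLaw.integralX N 1 (GramLaw.gramInterval N) = 0) ∧
    -- the explicit formula for the integral of `X²` over a pair of Gram intervals
    (∀ N : ℕ, 3 ≤ N →
      GramLaw.integralX N 2 (GramLaw.gramInterval N) =
        4 / Real.pi ^ 2 *
          (1 / ((N : ℝ) ^ 2 - 1) * Real.sin (Real.pi / N) ^ 2 -
            ∑ k₁ ∈ Finset.Icc 1 (N - 1), ∑ k₂ ∈ Finset.Icc 1 (N - 1),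
              if k₁ + k₂ = N then
                1 / ((k₁ : ℝ) * (k₂ : ℝ)) * Real.sin (k₁ * Real.pi / N) *
                  Real.sin (k₂ * Real.pi / N)
              else 0)) ∧
    -- its asymptotic behaviour
    ((fun N : ℕ => GramLaw.integralX N 2 (GramLaw.gramInterval N) - (-(GramLaw.alpha / N)))
      =O[atTop] fun N : ℕ => 1 / (N : ℝ) ^ 3) ∧
    |GramLaw.alpha - 0.987944| < 0.0000005 ∧
    -- the exact expansions of the probabilities, whose first correction is the `X²` term
    (∀ N : ℕ, 3 ≤ N →
      GramLaw.probSU N 0 (GramLaw.gramInterval N) =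
        GramLaw.probU N 0 (GramLaw.gramInterval N)
          + 1 / 2 * GramLaw.integralX N 2 (GramLaw.gramInterval N)
          + GramLaw.higherTerms N 0 (GramLaw.gramInterval N) ∧
      GramLaw.probSU N 1 (GramLaw.gramInterval N) =
        GramLaw.probU N 1 (GramLaw.gramInterval N)
          - GramLaw.integralX N 2 (GramLaw.gramInterval N)
          + GramLaw.higherTerms N 1 (GramLaw.gramInterval N) ∧
      GramLaw.probSU N 2 (GramLaw.gramInterval N) =
        GramLaw.probU N 2 (GramLaw.gramInterval N)
          + 1 / 2 * GramLaw.integralX N 2 (GramLaw.gramInterval N)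
          + GramLaw.higherTerms N 2 (GramLaw.gramInterval N)) ∧
    -- the resulting first-order corrections `-α/(2N)`, `+α/N`, `-α/(2N)`
    ((fun N : ℕ =>
        GramLaw.probSU N 0 (GramLaw.gramInterval N) -
          (GramLaw.probU N 0 (GramLaw.gramInterval N) - GramLaw.alpha / (2 * N)
            + GramLaw.higherTerms N 0 (GramLaw.gramInterval N)))
      =O[atTop] fun N : ℕ => 1 / (N : ℝ) ^ 3) ∧
    ((fun N : ℕ =>
        GramLaw.probSU N 1 (GramLaw.gramInterval N) -
          (GramLaw.probU N 1 (GramLaw.gramInterval N) + GramLaw.alpha / N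
            + GramLaw.higherTerms N 1 (GramLaw.gramInterval N)))
      =O[atTop] fun N : ℕ => 1 / (N : ℝ) ^ 3) ∧
    ((fun N : ℕ =>
        GramLaw.probSU N 2 (GramLaw.gramInterval N) -
          (GramLaw.probU N 2 (GramLaw.gramInterval N) - GramLaw.alpha / (2 * N)
            + GramLaw.higherTerms N 2 (GramLaw.gramInterval N)))
      =O[atTop] fun N : ℕ => 1 / (N : ℝ) ^ 3) := by
  have h0 : ∀ N : ℕ, 3 ≤ N → _ := fun N hN => GramLaw.probSU_expansion (k := 0) hN (by norm_num)
  have h1 : ∀ N : ℕ, 3 ≤ N → _ := fun N hN => GramLaw.probSU_expansion (k := 1) hN (by norm_num)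
  have h2 : ∀ N : ℕ, 3 ≤ N → _ := fun N hN => GramLaw.probSU_expansion (k := 2) hN (by norm_num)
  refine ⟨fun N hN => GramLaw.integralX_gram_one hN, fun N hN => ?_, GramLaw.integralX_two_isBigO,
    GramLaw.abs_alpha_sub_lt, fun N hN => ⟨?_, ?_, ?_⟩, ?_, ?_, ?_⟩
  · rw [GramLaw.double_sum_eq_sineSum (by omega), GramLaw.integralX_two hN]
  · rw [h0 N hN]; norm_num
  · rw [h1 N hN]; norm_num; ring
  · rw [h2 N hN]; norm_num
  · refine (GramLaw.probSU_expansion_isBigO (k := 0) (by norm_num)).congr_left fun N => ?_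
    norm_num; ring
  · refine (GramLaw.probSU_expansion_isBigO (k := 1) (by norm_num)).congr_left fun N => ?_
    norm_num
  · refine (GramLaw.probSU_expansion_isBigO (k := 2) (by norm_num)).congr_left fun N => ?_
    norm_num; ring
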